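/- **Proposition 3.1 (Recursive $L^p$-estimate).** Let $(\mathbb{X},\mathcal{X})$ be a measurable space with a $\sigma$-finite measure $\mu$. Let $\mathsf{N}(\mathbb{X})$ be the space of $\sigma$-finite counting measures on $\mathbb{X}$ (the $\sigma$-finite measures that are countable sums $\sum_i\delta_{x_i}$ of Dirac measures, repetitions allowed), with the smallest $\sigma$-field that makes the evaluations $\xi\mapsto\xi(B)$, $B\in\mathcal{X}$, measurable. Let $\eta$ be a Poisson process on $\mathbb{X}$ with intensity measure $\mu$, that is, a measurable map from a probability space $(\Omega,\mathcal{F},\mathbb{P})$ to $\mathsf{N}(\mathbb{X})$ such that $\eta(B)$ is Poisson distributed with mean $\mu(B)$ for all $B\in\mathcal{X}$ (almost surely $\infty$ if $\mu(B)=\infty$), and $\eta(B_1),\dots,\eta(B_n)$ are independent for all $n$ and all pairwise disjoint $B_1,\dots,B_n\in\mathcal{X}$. Let $F\in L^1(\mathbb{P}_\eta)$ be a Poisson functional with representative $f$, i.e. $f:\mathsf{N}(\mathbb{X})\to\mathbb{R}$ is measurable, $F=f(\eta)$ $\mathbb{P}$-almost surely, and $\mathbb{E}|F|<\infty$. For $x\in\mathbb{R}$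 write $x_+=\max\{0,x\}$ and $x_-=\min\{0,x\}$, put $D_xF=f(\eta+\delta_x)-f(\eta)$ for $x\in\mathbb{X}$, and $$V^+=\int_{\mathbb{X}}(D_xF)_-^2\,\mu(\mathrm{d}x)+\int_{\mathbb{X}}\big(f(\eta)-f(\eta-\delta_x)\big)_+^2\,\eta(\mathrm{d}x)\in[0,\infty],$$ where the second integral is the sum over the points $x$ of $\eta$, counted with multiplicity. For $q>0$ let $\|G\|_q=(\mathbb{E}[|G|^q])^{1/q}\in[0,\infty]$. Then, for every real $p\ge 2$, $$\|(F-\mathbb{E}F)_+\|_p^p\le\|(F-\mathbb{E}F)_+\|_{p-1}^p+(p-1)\,\|V^+\|_{p/2}\,\|(F-\mathbb{E}F)_+\|_p^{p-2},$$ as an inequality in $[0,\infty]$, with the conventions $0\cdot\infty=0$ and $a^0=1$ for all $a\in[0,\infty]$. -/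

import Mathlib

open MeasureTheory ProbabilityTheory
open scoped ENNReal

/-- The space `N(X)` of `σ`-finite counting measures on `X`: the `σ`-finite measures that are
countable sums of Dirac measures (repeated points are allowed, and the sum may be empty). As a
subtype of `Measure X` it carries the smallest `σ`-field that makes all the evaluations
`ξ ↦ ξ B`, with `B` measurable, measurable. -/
abbrev CountingMeasure (X : Type*) [MeasurableSpace X] : Type _ :=
  {ξ : Measure X // SigmaFinite ξ ∧
    ∃ (ι : Type) (_ : Countable ι) (x : ι → X), ξ = Measure.sum fun i => Measure.dirac (x i)}

namespace CountingMeasure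

variable {X : Type*} [MeasurableSpace X]

/-- The counting measure `ξ + δ_x`. -/
noncomputable def add (ξ : CountingMeasure X) (x : X) : CountingMeasure X :=
  ⟨ξ.1 + Measure.dirac x, by
    obtain ⟨ξ, hσ, ι, hι, y, hy⟩ := ξ
    refine ⟨inferInstance, ι ⊕ Unit, inferInstance, Sum.elim y fun _ => x, ?_⟩
    ext B hB
    simp only [hy, Measure.add_apply, Measure.sum_apply _ hB]
    have h : HasSum (fun i : ι ⊕ Unit => Measure.dirac (Sum.elim y (fun _ => x) i) B)
        ((∑' i, Measure.dirac (y i) B) + Measure.dirac x B) := by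
      refine HasSum.sum ENNReal.summable.hasSum ?_
      exact hasSum_unique fun _ : Unit => Measure.dirac x B
    exact h.tsum_eq.symm⟩

open Classical in
/-- The counting measure `ξ - δ_x`: the counting measure `ζ` with `ζ + δ_x = ξ`, if there is one
(it is then unique, see `sub_add`); this is the case for every point `x` of `ξ`
(see `sub_point_add`). Otherwise there is nothing to remove and the value is `ξ`. -/
noncomputable def sub (ξ : CountingMeasure X) (x : X) : CountingMeasure X :=
  if h : ∃ ζ : CountingMeasure X, ζ.add x = ξ then h.choose else ξ

lemma add_injective {ζ ζ' : CountingMeasure X} {x : X} (h : ζ.add x = ζ'.add x) : ζ = ζ' := by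
  have h1 : ζ.1 + Measure.dirac x = ζ'.1 + Measure.dirac x := congrArg Subtype.val h
  apply Subtype.ext
  rw [← Measure.add_sub_cancel (μ := ζ.1) (ν := Measure.dirac x), h1, Measure.add_sub_cancel]

lemma sub_add (ζ : CountingMeasure X) (x : X) : (ζ.add x).sub x = ζ := by
  have h : ∃ ζ' : CountingMeasure X, ζ'.add x = ζ.add x := ⟨ζ, rfl⟩
  rw [sub, dif_pos h]
  exact add_injective h.choose_spec

/-- A countable index set for an enumeration of the points of `ξ`, with multiplicities. -/
def Index (ξ : CountingMeasure X) : Type := ξ.2.2.choose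

instance (ξ : CountingMeasure X) : Countable ξ.Index := ξ.2.2.choose_spec.choose

/-- An enumeration of the points of `ξ`, with multiplicities. -/
noncomputable def point (ξ : CountingMeasure X) : ξ.Index → X :=
  ξ.2.2.choose_spec.choose_spec.choose

lemma eq_sum_dirac (ξ : CountingMeasure X) :
    ξ.1 = Measure.sum fun i : ξ.Index => Measure.dirac (ξ.point i) :=
  ξ.2.2.choose_spec.choose_spec.choose_spec

/-- Removing a point of `ξ` is a genuine subtraction. -/
lemma sub_point_add (ξ : CountingMeasure X) (i : ξ.Index) :
    (ξ.sub (ξ.point i)).add (ξ.point i) = ξ := by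
  have key : ξ.1 = (Measure.sum fun j : ({i}ᶜ : Set ξ.Index) => Measure.dirac (ξ.point j)) +
      Measure.dirac (ξ.point i) := by
    conv_lhs => rw [ξ.eq_sum_dirac,
      ← Measure.sum_add_sum_compl {i} fun j => Measure.dirac (ξ.point j)]
    rw [add_comm]
    congr 1
    ext B hB
    rw [Measure.sum_apply _ hB, tsum_fintype]
    simp
  have hσ : SigmaFinite ξ.1 := ξ.2.1
  have h : ∃ ζ : CountingMeasure X, ζ.add (ξ.point i) = ξ := by
    refine ⟨⟨Measure.sum fun j : ({i}ᶜ : Set ξ.Index) => Measure.dirac (ξ.point j), ?_,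
      _, inferInstance, _, rfl⟩, Subtype.ext key.symm⟩
    refine Measure.sigmaFinite_of_le ξ.1 ?_
    rw [key]
    exact Measure.le_add_right le_rfl
  rw [sub, dif_pos h]
  exact h.choose_spec

/-- The integral `∫ h(x) ξ(dx)` of a non-negative function against the counting measure
`ξ = ∑ δ_{x_i}`, that is, the sum `∑ h(x_i)`. For measurable `h` it is the Lebesgue integral (see
`integral_eq_lintegral`). The sum also makes sense if `h` is only defined, or only measurable, on
the points of `ξ` (which need not form a measurable set), as for functions that involve `ξ - δ_x`;
it is independent of the enumeration whenever `h x` depends on `x` only through `δ_x`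
(see `integral_eq_tsum`). -/
noncomputable def integral (ξ : CountingMeasure X) (h : X → ℝ≥0∞) : ℝ≥0∞ :=
  ∑' i : ξ.Index, h (ξ.point i)

lemma integral_eq_lintegral (ξ : CountingMeasure X) {h : X → ℝ≥0∞} (hh : Measurable h) :
    ξ.integral h = ∫⁻ x, h x ∂ξ.1 := by
  rw [ξ.eq_sum_dirac, lintegral_sum_measure, integral]
  simp only [lintegral_dirac' _ hh]

lemma integral_eq_tsum (ξ : CountingMeasure X) {h : X → ℝ≥0∞}
    (hh : ∀ x y : X, Measure.dirac x = Measure.dirac y → h x = h y)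
    {ι : Type} [Countable ι] (x : ι → X) (hx : ξ.1 = Measure.sum fun i => Measure.dirac (x i)) :
    ξ.integral h = ∑' i, h (x i) := by
  classical
  let z : ξ.Index ⊕ ι → X := Sum.elim ξ.point x
  have sep : ∀ a b : ξ.Index ⊕ ι, ∃ S : Set X, MeasurableSet S ∧ z a ∈ S ∧
      (z b ∈ S → h (z b) = h (z a)) := by
    intro a b
    by_cases hab : Measure.dirac (z a) = Measure.dirac (z b)
    · exact ⟨Set.univ, MeasurableSet.univ, trivial, fun _ => (hh _ _ hab).symm⟩
    · rw [← ne_eq, dirac_ne_dirac_iff_exists_measurableSet] at hab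
      obtain ⟨A, hA, h1, h2⟩ := hab
      exact ⟨A, hA, h1, fun h3 => absurd h3 h2⟩
  choose S hS hmem hsep using sep
  let H : X → ℝ≥0∞ := fun y => ⨆ a, (⋂ b, S a b).indicator (fun _ => h (z a)) y
  have hH : Measurable H :=
    Measurable.iSup fun a => measurable_const.indicator (MeasurableSet.iInter fun b => hS a b)
  have hHz : ∀ b, H (z b) = h (z b) := by
    intro b
    apply le_antisymm
    · refine iSup_le fun a => ?_
      by_cases hb : z b ∈ ⋂ c, S a c
      · rw [Set.indicator_of_mem hb, hsep a b (Set.mem_iInter.1 hb b)]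
      · rw [Set.indicator_of_notMem hb]
        exact zero_le
    · refine le_iSup_of_le b ?_
      rw [Set.indicator_of_mem (Set.mem_iInter.2 fun c => hmem b c)]
  have e1 : ξ.integral h = ∫⁻ y, H y ∂ξ.1 := by
    rw [← ξ.integral_eq_lintegral hH]
    exact tsum_congr fun i => (hHz (Sum.inl i)).symm
  rw [e1, hx, lintegral_sum_measure]
  refine tsum_congr fun i => ?_
  rw [lintegral_dirac' _ hH]
  exact hHz (Sum.inr i)

end CountingMeasure

/-- `η` is a Poisson process on `X` with intensity measure `μ`, defined on `(Ω, P)`. In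
`law_of_ne_top`, `η(B)` has the Poisson distribution with mean `μ(B) < ∞`, on `ℕ ⊆ [0, ∞]`; the
Poisson distribution with mean `∞` is the unit mass at `∞`. -/
structure IsPoissonProcess {X Ω : Type*} [MeasurableSpace X] [MeasurableSpace Ω]
    (P : Measure Ω) (μ : Measure X) (η : Ω → CountingMeasure X) : Prop where
  measurable : Measurable η
  law_of_ne_top : ∀ B : Set X, MeasurableSet B → μ B ≠ ∞ →
    P.map (fun ω => (η ω).1 B) =
      (poissonMeasure (μ B).toNNReal).map (fun n : ℕ => (n : ℝ≥0∞))
  law_of_eq_top : ∀ B : Set X, MeasurableSet B → μ B = ∞ → ∀ᵐ ω ∂P, (η ω).1 B = ∞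
  indep : ∀ (n : ℕ) (B : Fin n → Set X), (∀ i, MeasurableSet (B i)) →
    Pairwise (fun i j => Disjoint (B i) (B j)) → iIndepFun (fun i ω => (η ω).1 (B i)) P

/-- `F` is a Poisson functional, that is, almost surely `F = f(η)`, with the measurable
representative `f`. -/
structure IsRepresentative {X Ω : Type*} [MeasurableSpace X] [MeasurableSpace Ω]
    (P : Measure Ω) (η : Ω → CountingMeasure X) (F : Ω → ℝ) (f : CountingMeasure X → ℝ) :
    Prop where
  measurable : Measurable f
  ae_eq : F =ᵐ[P] fun ω => f (η ω)

/-- The difference operator `D_x F = f(ξ + δ_x) - f(ξ)`, at `η = ξ`. -/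
noncomputable def diffOp {X : Type*} [MeasurableSpace X] (f : CountingMeasure X → ℝ) (x : X)
    (ξ : CountingMeasure X) : ℝ :=
  f (ξ.add x) - f ξ

/-- `V⁺ = ∫ (D_x F)_-² μ(dx) + ∫ (f(ξ) - f(ξ - δ_x))_+² ξ(dx)`, at `η = ξ`, where
`x_- = min {0, x}` and `x_+ = max {0, x}`. -/
noncomputable def vPlus {X : Type*} [MeasurableSpace X] (μ : Measure X)
    (f : CountingMeasure X → ℝ) (ξ : CountingMeasure X) : ℝ≥0∞ :=
  (∫⁻ x, ENNReal.ofReal (min 0 (diffOp f x ξ) ^ 2) ∂μ) +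
    ξ.integral fun x => ENNReal.ofReal (max 0 (f ξ - f (ξ.sub x)) ^ 2)

/-- `‖G‖_p = (E |G|^p)^{1/p}`, with values in `[0, ∞]`. -/
noncomputable def pNorm {Ω E : Type*} [MeasurableSpace Ω] [ENorm E] (P : Measure Ω) (p : ℝ)
    (G : Ω → E) : ℝ≥0∞ :=
  (∫⁻ ω, ‖G ω‖ₑ ^ p ∂P) ^ (1 / p)

/-! Put `r = p / (p - 1)`, so that `1 < r ≤ 2`, and `φ(x) = x ^ r`. The core is the `φ`-entropy
inequality `E φ(G) - φ(E G) ≤ E ∫ B(G(η), G(η + δ_x)) μ(dx)` (`IsPoissonProcess.powEnt_le`), where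
`B` is the Bregman divergence of `φ`. It is applied to `G = U ^ (p - 1)`, with `U` the positive part
of `F - m` truncated to an interval `[c, n]`, `0 < c`. Since `G ^ r = U ^ p`, its left side is `E U
^ p - (E U ^ (p - 1)) ^ (p / (p - 1))`, which is the shape of the claim.

For the right side, `powBregman_rpow_le` bounds `B(u ^ (p - 1), v ^ (p - 1))` by `p - 1` times the
squared increment, weighted with the `(p - 2)`-th power of the larger of `u` and `v`. Downward jumps
carry the weight at `η` and give the first integral in `V⁺`. Upward jumps carry the weight at `η +
δ_x`, and the Mecke formula turns them into the sum over the points of `η`. This produces `(p - 1)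
E[(F - m)₊ ^ (p - 2) V⁺]`, and Hölder's inequality with exponents `p / 2` and `p / (p - 2)` finishes
the proof once the truncations are removed.

The entropy inequality rests on the joint convexity of `B` (`powBregman_tangent`), which is where `r
≤ 2` enters: it makes the entropy convex, hence subadditive over products (`powEnt_prod_le`). For
one Poisson variable a crude bound has an error quadratic in the mean; splitting the variable into
many independent ones of small mean removes the error. Subadditivity then gives the case of finitely
many independent Poisson variables, that is, of functionals of the counts in finitely many disjoint
sets. General bounded functionals follow by `L¹` approximation, where the Mecke formula controls the
error at `η + δ_x`. -/

/-! ### Real inequalities: joint convexity and size of the Bregman divergence of a power. -/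

/-- The Bregman divergence `φ(b) - φ(a) - φ'(a) (b - a)` of the power function `φ(x) = x ^ r`. -/
noncomputable def powBregman (r a b : ℝ) : ℝ :=
  b ^ r + (r - 1) * a ^ r - r * a ^ (r - 1) * b

lemma rpow_young {r p b w : ℝ} (hrp : r.HolderConjugate p) (hb : 0 ≤ b) (hw : 0 ≤ w) :
    r * w * b ≤ b ^ r + (r - 1) * w ^ p := by
  have h := Real.young_inequality_of_nonneg hb hw hrp
  have hr : 0 < r := hrp.pos
  have hp : r * p⁻¹ = r - 1 := by
    have := hrp.inv_add_inv_eq_one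
    have h2 : p⁻¹ = 1 - r⁻¹ := by linarith
    rw [h2]; field_simp
  calc r * w * b = r * (b * w) := by ring
    _ ≤ r * (b ^ r / r + w ^ p / p) := by gcongr
    _ = b ^ r + (r * p⁻¹) * w ^ p := by field_simp
    _ = _ := by rw [hp]

lemma rpow_sub_one_rpow {r p a : ℝ} (hrp : r.HolderConjugate p) (ha : 0 ≤ a) :
    (a ^ (r - 1)) ^ p = a ^ r := by
  rw [← Real.rpow_mul ha, hrp.sub_one_mul_conj]

lemma rpow_sub_one_mul_self {r a : ℝ} (hr : 1 < r) (ha : 0 ≤ a) : a ^ (r - 1) * a = a ^ r := by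
  rcases ha.eq_or_lt with rfl | ha
  · rw [Real.zero_rpow (by linarith), Real.zero_rpow (by linarith), zero_mul]
  · rw [Real.rpow_sub_one ha.ne']; field_simp

/-- Young's inequality with `w = a ^ (r - 1)`, for which `w ^ p = a ^ r`. -/
lemma powBregman_nonneg {r a b : ℝ} (hr : 1 < r) (ha : 0 ≤ a) (hb : 0 ≤ b) :
    0 ≤ powBregman r a b := by
  have hrp := Real.HolderConjugate.conjExponent hr
  have h := rpow_young hrp hb (Real.rpow_nonneg ha (r - 1))
  rw [rpow_sub_one_rpow hrp ha] at h
  rw [powBregman]; linarith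

lemma powBregman_self {r a : ℝ} (hr : 1 < r) (ha : 0 ≤ a) : powBregman r a a = 0 := by
  have := rpow_sub_one_mul_self hr ha
  rw [powBregman]; linear_combination -r * this

/-- The sign of the derivative in `rpow_add_sub_one_le`, to the right of `1`. -/
lemma rpow_add_sub_one_le_mul {p x y : ℝ} (hp : 2 ≤ p) (hx : 1 ≤ x) (hy : 0 ≤ y) :
    (x + y - 1) ^ (p - 1) ≤ x ^ (p - 2) * (x - 1 + y ^ (p - 1)) := by
  have hx0 : 0 < x := by linarith
  -- `(x + y - 1) / x` is the convex combination of `1` and `y` with weights `1 - 1 / x` and `1 /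
  -- x`.
  have hc := (convexOn_rpow (show 1 ≤ p - 1 by linarith)).2 (Set.mem_Ici.2 zero_le_one)
    (Set.mem_Ici.2 hy) (show 0 ≤ 1 - x⁻¹ by
      rw [sub_nonneg]; exact inv_le_one_of_one_le₀ hx) (inv_nonneg.2 hx0.le) (by ring)
  simp only [smul_eq_mul, Real.one_rpow, mul_one] at hc
  have e : x + y - 1 = x * (1 - x⁻¹ + x⁻¹ * y) := by field_simp; ring
  have hz : 0 ≤ 1 - x⁻¹ + x⁻¹ * y := by
    have : 0 ≤ 1 - x⁻¹ := by rw [sub_nonneg]; exact inv_le_one_of_one_le₀ hx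
    positivity
  rw [e, Real.mul_rpow hx0.le hz]
  have e2 : x ^ (p - 1) = x ^ (p - 2) * x := by
    rw [← Real.rpow_add_one hx0.ne']; ring_nf
  rw [e2, mul_assoc]
  refine mul_le_mul_of_nonneg_left ?_ (Real.rpow_nonneg hx0.le _)
  calc x * (1 - x⁻¹ + x⁻¹ * y) ^ (p - 1) ≤ x * (1 - x⁻¹ + x⁻¹ * y ^ (p - 1)) := by gcongr
    _ = _ := by field_simp

/-- The sign of the derivative in `rpow_add_sub_one_le`, to the left of `1`. -/
lemma mul_le_rpow_add_sub_one {p x y : ℝ} (hp : 2 ≤ p) (hx0 : 0 < x) (hx : x ≤ 1)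
    (hxy : 0 ≤ x + y - 1) :
    x ^ (p - 2) * (x - 1 + y ^ (p - 1)) ≤ (x + y - 1) ^ (p - 1) := by
  have hz : 0 ≤ (x + y - 1) / x := by positivity
  -- Here `y` is the convex combination of `1` and `(x + y - 1) / x` with weights `1 - x` and `x`.
  have hc := (convexOn_rpow (show 1 ≤ p - 1 by linarith)).2 (Set.mem_Ici.2 zero_le_one)
    (Set.mem_Ici.2 hz) (show 0 ≤ 1 - x by linarith) hx0.le (by ring)
  simp only [smul_eq_mul, Real.one_rpow, mul_one] at hc
  have e : 1 - x + x * ((x + y - 1) / x) = y := by field_simp; ring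
  rw [e] at hc
  have e3 : (x + y - 1) ^ (p - 1) = x ^ (p - 2) * (x * ((x + y - 1) / x) ^ (p - 1)) := by
    rw [Real.div_rpow hxy hx0.le]
    have e2 : x ^ (p - 1) = x ^ (p - 2) * x := by
      rw [← Real.rpow_add_one hx0.ne']; ring_nf
    rw [e2]
    have := Real.rpow_pos_of_pos hx0 (p - 2)
    field_simp
  rw [e3]
  refine mul_le_mul_of_nonneg_left ?_ (Real.rpow_nonneg hx0.le _)
  linarith

/-- Fix `y` and vary `x`: where `x + y ≥ 1`, the right side minus the left is smallest at `x = 1`,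
where it vanishes. The sign of the derivative comes from the two preceding lemmas. This is the dual
form of the tangent plane inequality for `B`. -/
lemma rpow_add_sub_one_le {p r x y : ℝ} (hp : 2 ≤ p) (hr : r * (p - 1) = p) (hx : 0 ≤ x)
    (hy : 0 ≤ y) :
    max (x + y - 1) 0 ^ p ≤
      x ^ p + y ^ p - 1 + r * ((x ^ (p - 1) - 1) * (y ^ (p - 1) - 1)) := by
  set d : ℝ := y ^ (p - 1) - 1 with hd
  let h1 : ℝ → ℝ := fun t => r * ((t ^ (p - 1) - 1) * d) + t ^ p
  let h2 : ℝ → ℝ := fun t => h1 t - (t + y - 1) ^ p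
  have hp0 : 0 ≤ p := by linarith
  have c1 : Continuous h1 := by
    have := Real.continuous_rpow_const hp0
    have := Real.continuous_rpow_const (show 0 ≤ p - 1 by linarith)
    fun_prop
  have c2 : Continuous h2 := by
    refine c1.sub ((Real.continuous_rpow_const hp0).comp (by fun_prop))
  have d1 : ∀ t, 0 < t → HasDerivAt h1 (p * (t ^ (p - 2) * (t - 1 + y ^ (p - 1)))) t := by
    intro t ht
    have a1 := Real.hasDerivAt_rpow_const (x := t) (p := p - 1) (Or.inl ht.ne')
    have a2 := Real.hasDerivAt_rpow_const (x := t) (p := p) (Or.inl ht.ne')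
    have := (((a1.sub_const 1).mul_const d).const_mul r).add a2
    refine this.congr_deriv ?_
    have e2 : t ^ (p - 1) = t ^ (p - 2) * t := by
      rw [← Real.rpow_add_one ht.ne']; ring_nf
    rw [e2, show p - 1 - 1 = p - 2 by ring, hd]
    linear_combination (t ^ (p - 2) * (y ^ (p - 1) - 1)) * hr
  have d2 : ∀ t, 0 < t → 0 < t + y - 1 → HasDerivAt h2
      (p * (t ^ (p - 2) * (t - 1 + y ^ (p - 1)) - (t + y - 1) ^ (p - 1))) t := by
    intro t ht hty
    have a2 := (Real.hasDerivAt_rpow_const (x := t + y - 1) (p := p) (Or.inl hty.ne')).comp t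
      (((hasDerivAt_id t).add_const y).sub_const 1)
    refine ((d1 t ht).sub a2).congr_deriv ?_
    ring
  have e1 : h2 1 = 1 - y ^ p := by
    simp [h1, h2]
  have key : ∀ t, 0 ≤ t → 0 ≤ t + y - 1 → h2 1 ≤ h2 t := by
    intro t ht hty
    rcases le_total 1 t with h | h
    · have hm : MonotoneOn h2 (Set.Icc 1 t) := by
        refine monotoneOn_of_deriv_nonneg (convex_Icc _ _) c2.continuousOn ?_ ?_
        · intro u hu
          rw [interior_Icc] at hu
          exact (d2 u (by linarith [hu.1]) (by linarith [hu.1])).differentiableAt.differentiableWithinAt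
        · intro u hu
          rw [interior_Icc] at hu
          rw [(d2 u (by linarith [hu.1]) (by linarith [hu.1])).deriv]
          have := rpow_add_sub_one_le_mul hp hu.1.le hy
          exact mul_nonneg hp0 (by linarith)
      exact hm ⟨le_rfl, h⟩ ⟨h, le_rfl⟩ h
    · have hm : AntitoneOn h2 (Set.Icc t 1) := by
        refine antitoneOn_of_deriv_nonpos (convex_Icc _ _) c2.continuousOn ?_ ?_
        · intro u hu
          rw [interior_Icc] at hu
          exact (d2 u (by linarith [hu.1]) (by linarith [hu.1])).differentiableAt.differentiableWithinAt
        · intro u hu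
          rw [interior_Icc] at hu
          rw [(d2 u (by linarith [hu.1]) (by linarith [hu.1])).deriv]
          have := mul_le_rpow_add_sub_one (y := y) hp (by linarith [hu.1] : 0 < u) hu.2.le
            (by linarith [hu.1])
          exact mul_nonpos_of_nonneg_of_nonpos hp0 (by linarith)
      exact hm ⟨le_rfl, h⟩ ⟨h, le_rfl⟩ h
  rcases le_total 0 (x + y - 1) with hxy | hxy
  · rw [max_eq_left hxy]
    have := key x hx hxy
    rw [e1] at this
    simp only [h2, h1] at this
    linarith
  · rw [max_eq_right hxy, Real.zero_rpow (by linarith)]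
    -- The left side is now zero. The right side decreases in its first variable on `[x, 1 - y]`,
    -- because `y ^ (p - 1) ≤ y`, so the endpoint `1 - y` of the previous case suffices.
    have hy1 : y ≤ 1 := by linarith
    have k1 := key (1 - y) (by linarith) (by linarith)
    have hm : AntitoneOn h1 (Set.Icc x (1 - y)) := by
      refine antitoneOn_of_deriv_nonpos (convex_Icc _ _) c1.continuousOn ?_ ?_
      · intro u hu
        rw [interior_Icc] at hu
        exact (d1 u (by linarith [hu.1])).differentiableAt.differentiableWithinAt
      · intro u hu
        rw [interior_Icc] at hu
        have hu0 : 0 < u := by linarith [hu.1]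
        rw [(d1 u hu0).deriv]
        have : y ^ (p - 1) ≤ y := by
          simpa using Real.rpow_le_rpow_of_exponent_ge' hy hy1 zero_le_one
            (show 1 ≤ p - 1 by linarith)
        refine mul_nonpos_of_nonneg_of_nonpos hp0 (mul_nonpos_of_nonneg_of_nonpos
          (Real.rpow_nonneg hu0.le _) ?_)
        linarith [hu.2]
    have k2 := hm ⟨le_rfl, by linarith⟩ ⟨by linarith, le_rfl⟩ (by linarith : x ≤ 1 - y)
    rw [e1] at k1
    simp only [h2, show 1 - y + y - 1 = 0 by ring, Real.zero_rpow (by linarith : p ≠ 0)] at k1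
    simp only [h1] at k1 k2
    linarith

/-- For fixed `a`, the difference of the two sides is `b ^ r - r (β ^ (r - 1) + a ^ (r - 1) - 1) b`
plus a constant. Young's inequality with `w` the positive part of the bracket gives its minimum over
`b ≥ 0`; what remains is `rpow_add_sub_one_le` for `x = β ^ (r - 1)` and `y = a ^ (r - 1)`. -/
lemma powBregman_tangent_one {r a b β : ℝ} (hr : 1 < r) (hr2 : r ≤ 2) (ha : 0 ≤ a) (hb : 0 ≤ b)
    (hβ : 0 ≤ β) :
    powBregman r 1 β - r * (r - 1) * (β - 1) * (a - 1) + r * (β ^ (r - 1) - 1) * (b - β) ≤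
      powBregman r a b := by
  have hrp := Real.HolderConjugate.conjExponent hr
  set p := r.conjExponent with hpdef
  have hpe : r * (p - 1) = p := by linarith [hrp.mul_eq_add]
  have hp : 2 ≤ p := by
    rw [hpdef, Real.conjExponent, le_div_iff₀ (by linarith)]; linarith
  have inv : ∀ z : ℝ, 0 ≤ z → (z ^ (r - 1)) ^ (p - 1) = z := by
    intro z hz
    rw [← Real.rpow_mul hz]
    have : (r - 1) * (p - 1) = 1 := by linear_combination hrp.mul_eq_add
    rw [this, Real.rpow_one]
  have k := rpow_add_sub_one_le hp hpe (Real.rpow_nonneg hβ (r - 1)) (Real.rpow_nonneg ha (r - 1))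
  rw [inv β hβ, inv a ha, rpow_sub_one_rpow hrp hβ, rpow_sub_one_rpow hrp ha] at k
  have y := rpow_young hrp hb (le_max_right (β ^ (r - 1) + a ^ (r - 1) - 1) 0)
  have y2 : r * (β ^ (r - 1) + a ^ (r - 1) - 1) * b ≤
      r * max (β ^ (r - 1) + a ^ (r - 1) - 1) 0 * b := by
    have := le_max_left (β ^ (r - 1) + a ^ (r - 1) - 1) 0
    gcongr
  have e := rpow_sub_one_mul_self hr hβ
  have k2 := mul_le_mul_of_nonneg_left k (show 0 ≤ r - 1 by linarith)
  simp only [powBregman, Real.one_rpow]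
  nlinarith

/-- The Bregman divergence of `x ^ r`, `1 < r ≤ 2`, is jointly convex: it lies above its tangent
planes. -/
lemma powBregman_tangent {r a b a₀ b₀ : ℝ} (hr : 1 < r) (hr2 : r ≤ 2) (ha : 0 ≤ a) (hb : 0 ≤ b)
    (ha₀ : 0 < a₀) (hb₀ : 0 ≤ b₀) :
    powBregman r a₀ b₀ - r * (r - 1) * a₀ ^ (r - 2) * (b₀ - a₀) * (a - a₀) +
      r * (b₀ ^ (r - 1) - a₀ ^ (r - 1)) * (b - b₀) ≤ powBregman r a b := by
  -- Both sides are homogeneous of degree `r`, so `a₀` can be scaled to `1`.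
  obtain ⟨a, rfl⟩ : ∃ a', a = a₀ * a' := ⟨a / a₀, by field_simp⟩
  obtain ⟨b, rfl⟩ : ∃ a', b = a₀ * a' := ⟨b / a₀, by field_simp⟩
  obtain ⟨β, rfl⟩ : ∃ a', b₀ = a₀ * a' := ⟨b₀ / a₀, by field_simp⟩
  have ha' : 0 ≤ a := nonneg_of_mul_nonneg_right ha ha₀
  have hb' : 0 ≤ b := nonneg_of_mul_nonneg_right hb ha₀
  have hβ : 0 ≤ β := nonneg_of_mul_nonneg_right hb₀ ha₀
  have k := powBregman_tangent_one hr hr2 ha' hb' hβ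
  have hs : 0 < a₀ ^ (r - 2) := Real.rpow_pos_of_pos ha₀ _
  have e1 : a₀ ^ (r - 1) = a₀ ^ (r - 2) * a₀ := by
    rw [← Real.rpow_add_one ha₀.ne']; ring_nf
  have e2 : a₀ ^ r = a₀ ^ (r - 2) * a₀ * a₀ := by
    rw [← e1, ← Real.rpow_add_one ha₀.ne']; ring_nf
  have k2 := mul_le_mul_of_nonneg_left k (show 0 ≤ a₀ ^ (r - 2) * a₀ * a₀ by positivity)
  simp only [powBregman, Real.one_rpow, Real.mul_rpow ha₀.le ha', Real.mul_rpow ha₀.le hb',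
    Real.mul_rpow ha₀.le hβ, e1, e2] at k2 ⊢
  linarith

/-- In both inequalities the two sides agree at `t = 1`, and their difference is monotone: by
Bernoulli's inequality in the first, and by `t ^ (p - 2) ≤ 1` and `p ≤ 2 (p - 1)` in the second.
They are the cases `u ≤ v` and `v ≤ u` of `powBregman_rpow_le`, with the larger value scaled to `1`.
-/
lemma powBregman_rpow_le_of_le {p t : ℝ} (hp : 2 ≤ p) (ht : 0 ≤ t) (ht1 : t ≤ 1) :
    p - 1 + t ^ p - p * t ≤ (p - 1) ^ 2 * (1 - t) ^ 2 ∧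
      (p - 1) * t ^ p + 1 - p * t ^ (p - 1) ≤ (p - 1) ^ 2 * (1 - t) ^ 2 := by
  have c1 := Real.continuous_rpow_const (show 0 ≤ p by linarith)
  have c2 := Real.continuous_rpow_const (show 0 ≤ p - 1 by linarith)
  constructor
  · let h : ℝ → ℝ := fun t => (p - 1) ^ 2 * (1 - t) ^ 2 - (p - 1 + t ^ p - p * t)
    have d : ∀ u, 0 < u → HasDerivAt h
        (p * (1 - u ^ (p - 1)) - 2 * (p - 1) ^ 2 * (1 - u)) u := by
      intro u hu
      have a2 := Real.hasDerivAt_rpow_const (x := u) (p := p) (Or.inl hu.ne')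
      have a3 := (((hasDerivAt_id u).const_sub 1).pow 2).const_mul ((p - 1) ^ 2)
      refine (a3.sub ((a2.const_add (p - 1)).sub ((hasDerivAt_id u).const_mul p))).congr_deriv ?_
      simp; ring
    have hm : AntitoneOn h (Set.Icc t 1) := by
      refine antitoneOn_of_deriv_nonpos (convex_Icc _ _) (by fun_prop) ?_ ?_
      · intro u hu
        rw [interior_Icc] at hu
        exact (d u (by linarith [hu.1])).differentiableAt.differentiableWithinAt
      · intro u hu
        rw [interior_Icc] at hu
        have hu0 : 0 < u := by linarith [hu.1]
        rw [(d u hu0).deriv]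
        have b := one_add_mul_self_le_rpow_one_add (show -1 ≤ u - 1 by linarith)
          (show 1 ≤ p - 1 by linarith)
        rw [show 1 + (u - 1) = u by ring] at b
        have h1 : 0 ≤ (p - 1) * (1 - u) := mul_nonneg (by linarith) (by linarith [hu.2])
        nlinarith
    have := hm ⟨le_rfl, ht1⟩ ⟨ht1, le_rfl⟩ ht1
    simp [h] at this
    linarith
  · let h : ℝ → ℝ := fun t => (p - 1) ^ 2 * (1 - t) ^ 2 - ((p - 1) * t ^ p + 1 - p * t ^ (p - 1))
    have d : ∀ u, 0 < u → HasDerivAt h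
        ((p - 1) * (1 - u) * (p * u ^ (p - 2) - 2 * (p - 1))) u := by
      intro u hu
      have a1 := Real.hasDerivAt_rpow_const (x := u) (p := p - 1) (Or.inl hu.ne')
      have a2 := Real.hasDerivAt_rpow_const (x := u) (p := p) (Or.inl hu.ne')
      have a3 := (((hasDerivAt_id u).const_sub 1).pow 2).const_mul ((p - 1) ^ 2)
      refine (a3.sub (((a2.const_mul (p - 1)).add_const 1).sub (a1.const_mul p))).congr_deriv ?_
      have e2 : u ^ (p - 1) = u ^ (p - 2) * u := by
        rw [← Real.rpow_add_one hu.ne']; ring_nf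
      rw [e2, show p - 1 - 1 = p - 2 by ring]
      simp; ring
    have hm : AntitoneOn h (Set.Icc t 1) := by
      refine antitoneOn_of_deriv_nonpos (convex_Icc _ _) (by fun_prop) ?_ ?_
      · intro u hu
        rw [interior_Icc] at hu
        exact (d u (by linarith [hu.1])).differentiableAt.differentiableWithinAt
      · intro u hu
        rw [interior_Icc] at hu
        have hu0 : 0 < u := by linarith [hu.1]
        rw [(d u hu0).deriv]
        have b := Real.rpow_le_one hu0.le hu.2.le (show 0 ≤ p - 2 by linarith)
        have h1 : 0 ≤ (p - 1) * (1 - u) := mul_nonneg (by linarith) (by linarith [hu.2])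
        refine mul_nonpos_of_nonneg_of_nonpos h1 ?_
        nlinarith
    have := hm ⟨le_rfl, ht1⟩ ⟨ht1, le_rfl⟩ ht1
    simp [h] at this
    linarith

/-- The weight sits on the larger of the two values; this asymmetry is what leads to `V⁺`, with its
two one-sided squares. -/
lemma powBregman_rpow_le {p u v : ℝ} (hp : 2 ≤ p) (hu : 0 < u) (hv : 0 < v) :
    powBregman (p / (p - 1)) (u ^ (p - 1)) (v ^ (p - 1)) ≤
      (p - 1) * (u ^ (p - 2) * max (u - v) 0 ^ 2 + v ^ (p - 2) * max (v - u) 0 ^ 2) := by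
  have hp1 : 0 < p - 1 := by linarith
  have e : ∀ z : ℝ, 0 < z → (z ^ (p - 1)) ^ (p / (p - 1)) = z ^ p := by
    intro z hz
    rw [← Real.rpow_mul hz.le]; congr 1; field_simp
  have e' : (u ^ (p - 1)) ^ (p / (p - 1) - 1) = u := by
    rw [← Real.rpow_mul hu.le]
    rw [show (p - 1) * (p / (p - 1) - 1) = 1 by field_simp; ring, Real.rpow_one]
  have s2 : ∀ z : ℝ, 0 < z → z ^ p = z ^ (p - 2) * z ^ 2 := by
    intro z hz
    rw [← Real.rpow_natCast z 2, ← Real.rpow_add hz]; congr 1; norm_num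
  have s1 : ∀ z : ℝ, 0 < z → z ^ (p - 1) = z ^ (p - 2) * z := by
    intro z hz
    rw [← Real.rpow_add_one hz.ne']; congr 1; ring
  have key : v ^ p * (p - 1) + u ^ p - p * (u * v ^ (p - 1)) ≤ (p - 1) ^ 2 *
      (u ^ (p - 2) * max (u - v) 0 ^ 2 + v ^ (p - 2) * max (v - u) 0 ^ 2) := by
    rcases le_total u v with h | h
    · obtain ⟨t, rfl⟩ : ∃ t, u = v * t := ⟨u / v, by field_simp⟩
      have ht : 0 < t := pos_of_mul_pos_right hu hv.le
      have ht1 : t ≤ 1 := by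
        by_contra! hh; nlinarith
      have k := (powBregman_rpow_le_of_le hp ht.le ht1).1
      rw [max_eq_right (by linarith), max_eq_left (by linarith), Real.mul_rpow hv.le ht.le (z := p),
        s1 v hv, s2 v hv]
      have k2 := mul_le_mul_of_nonneg_left k
        (show 0 ≤ v ^ (p - 2) * v ^ 2 by have := Real.rpow_nonneg hv.le (p - 2); positivity)
      linarith
    · obtain ⟨t, rfl⟩ : ∃ t, v = u * t := ⟨v / u, by field_simp⟩
      have ht : 0 < t := pos_of_mul_pos_right hv hu.le
      have ht1 : t ≤ 1 := by
        by_contra! hh; nlinarith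
      have k := (powBregman_rpow_le_of_le hp ht.le ht1).2
      rw [max_eq_left (by linarith), max_eq_right (by linarith), Real.mul_rpow hu.le ht.le (z := p),
        Real.mul_rpow hu.le ht.le (z := p - 1), s1 u hu, s2 u hu]
      have k2 := mul_le_mul_of_nonneg_left k
        (show 0 ≤ u ^ (p - 2) * u ^ 2 by have := Real.rpow_nonneg hu.le (p - 2); positivity)
      linarith
  rw [powBregman, e u hu, e v hv, e']
  rw [← mul_le_mul_iff_right₀ hp1]
  refine le_trans (le_of_eq ?_) (key.trans (le_of_eq (by ring)))
  field_simp
  ring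

/-- Mean value theorem. The lower bound `c > 0` matters, since exponents below `1` occur and their
derivatives blow up at the origin. -/
lemma exists_rpow_lipschitz {q c M : ℝ} (hc : 0 < c) :
    ∃ L, 0 ≤ L ∧ ∀ a ∈ Set.Icc c M, ∀ b ∈ Set.Icc c M, |a ^ q - b ^ q| ≤ L * |a - b| := by
  have hne : ∀ x ∈ Set.Icc c M, x ≠ 0 := fun x hx => (hc.trans_le hx.1).ne'
  have hcont : ContinuousOn (fun x : ℝ => q * x ^ (q - 1)) (Set.Icc c M) := by
    refine continuousOn_const.mul ?_
    exact fun x hx => (Real.continuousAt_rpow_const x _ (Or.inl (hne x hx))).continuousWithinAt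
  obtain ⟨L, hL⟩ := isCompact_Icc.exists_bound_of_continuousOn hcont
  refine ⟨max L 0, le_max_right _ _, fun a ha b hb => ?_⟩
  exact (convex_Icc c M).norm_image_sub_le_of_norm_hasDerivWithin_le
    (fun x hx => (Real.hasDerivAt_rpow_const (Or.inl (hne x hx))).hasDerivWithinAt)
    (fun x hx => (hL x hx).trans (le_max_left _ _)) hb ha

lemma exists_powBregman_lipschitz {r c M : ℝ} (hr : 1 < r) (hc : 0 < c) :
    ∃ L, 0 ≤ L ∧ (∀ a ∈ Set.Icc c M, ∀ b ∈ Set.Icc c M, |a ^ r - b ^ r| ≤ L * |a - b|) ∧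
      ∀ a ∈ Set.Icc c M, ∀ b ∈ Set.Icc c M, ∀ a' ∈ Set.Icc c M, ∀ b' ∈ Set.Icc c M,
        |powBregman r a b - powBregman r a' b'| ≤ L * (|a - a'| + |b - b'|) := by
  obtain ⟨L₁, h₁, hL₁⟩ := exists_rpow_lipschitz (q := r) (M := M) hc
  obtain ⟨L₂, h₂, hL₂⟩ := exists_rpow_lipschitz (q := r - 1) (M := M) hc
  refine ⟨r * L₁ + r * |M| * L₂ + r * |M| ^ (r - 1), by positivity, fun a ha b hb => ?_,
    fun a ha b hb a' ha' b' hb' => ?_⟩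
  · refine (hL₁ a ha b hb).trans (mul_le_mul_of_nonneg_right ?_ (abs_nonneg _))
    have : 0 ≤ r * |M| * L₂ + r * |M| ^ (r - 1) := by positivity
    nlinarith
  · have k1 := hL₁ b hb b' hb'
    have k2 := hL₁ a ha a' ha'
    have k3 := hL₂ a ha a' ha'
    have hbM : |b| ≤ |M| := by
      rw [abs_of_pos (hc.trans_le hb.1)]; exact hb.2.trans (le_abs_self M)
    have haM : |a' ^ (r - 1)| ≤ |M| ^ (r - 1) := by
      have := hc.trans_le ha'.1
      rw [abs_of_pos (Real.rpow_pos_of_pos this _)]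
      exact Real.rpow_le_rpow this.le (ha'.2.trans (le_abs_self M)) (by linarith)
    have e : powBregman r a b - powBregman r a' b' = (b ^ r - b' ^ r) + (r - 1) * (a ^ r - a' ^ r) +
        (-r) * ((a ^ (r - 1) - a' ^ (r - 1)) * b) + (-r) * (a' ^ (r - 1) * (b - b')) := by
      simp only [powBregman]; ring
    have t1 : |(-r) * ((a ^ (r - 1) - a' ^ (r - 1)) * b)| ≤ r * (L₂ * |a - a'| * |M|) := by
      rw [abs_mul, abs_mul, abs_neg, abs_of_pos (by linarith : 0 < r)]
      gcongr
    have t2 : |(-r) * (a' ^ (r - 1) * (b - b'))| ≤ r * (|M| ^ (r - 1) * |b - b'|) := by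
      rw [abs_mul, abs_mul, abs_neg, abs_of_pos (by linarith : 0 < r)]
      gcongr
    have t3 : |(r - 1) * (a ^ r - a' ^ r)| ≤ (r - 1) * (L₁ * |a - a'|) := by
      rw [abs_mul, abs_of_pos (by linarith : 0 < r - 1)]
      gcongr
    rw [e]
    refine (abs_add_le _ _).trans ?_
    refine (add_le_add ((abs_add_le _ _).trans (add_le_add (abs_add_le _ _) le_rfl)) le_rfl).trans ?_
    have n1 : 0 ≤ L₁ * |a - a'| := by positivity
    have n2 : 0 ≤ (r - 1) * (L₁ * |b - b'|) := mul_nonneg (by linarith) (by positivity)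
    have n3 : 0 ≤ r * |M| * L₂ * |b - b'| := by positivity
    have n4 : 0 ≤ r * |M| ^ (r - 1) * |a - a'| := by positivity
    nlinarith

/-! ### Power entropies: variational formula, convexity and subadditivity. -/

/-- The entropy `∫ φ(g) dν - φ(∫ g dν)` for the power function `φ(x) = x ^ r`. -/
noncomputable def powEnt {E : Type*} [MeasurableSpace E] (r : ℝ) (ν : Measure E) (g : E → ℝ) : ℝ :=
  ∫ x, g x ^ r ∂ν - (∫ x, g x ∂ν) ^ r

section Entropy

variable {E E₁ E₂ : Type*} [MeasurableSpace E] [MeasurableSpace E₁] [MeasurableSpace E₂]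
  {r c M : ℝ}

lemma measurable_powBregman {a b : E → ℝ} (ha : Measurable a) (hb : Measurable b) :
    Measurable fun x => powBregman r (a x) (b x) := by
  unfold powBregman
  fun_prop

lemma integral_mem_Icc {ν : Measure E} [IsProbabilityMeasure ν] {g : E → ℝ} (hg : Measurable g)
    (hgm : ∀ x, g x ∈ Set.Icc c M) : ∫ x, g x ∂ν ∈ Set.Icc c M :=
  (convex_Icc c M).integral_mem isClosed_Icc (ae_of_all _ hgm)
    (Integrable.of_mem_Icc c M hg.aemeasurable (ae_of_all _ hgm))

lemma integrable_rpow_of_mem_Icc {ν : Measure E} [IsFiniteMeasure ν] {g : E → ℝ}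
    (hr : 1 < r) (hc : 0 < c) (hg : Measurable g)
    (hgm : ∀ x, g x ∈ Set.Icc c M) : Integrable (fun x => g x ^ r) ν := by
  refine Integrable.of_mem_Icc 0 (M ^ r) (by fun_prop) (ae_of_all _ fun x => ?_)
  have := hc.trans_le (hgm x).1
  exact ⟨Real.rpow_nonneg this.le _, Real.rpow_le_rpow this.le (hgm x).2 (by linarith)⟩

lemma exists_powBregman_le (hr : 1 < r) (hc : 0 < c) :
    ∃ K, 0 ≤ K ∧ ∀ a ∈ Set.Icc c M, ∀ b ∈ Set.Icc c M, powBregman r a b ≤ K := by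
  obtain ⟨L, hL0, -, hL⟩ := exists_powBregman_lipschitz (M := M) hr hc
  refine ⟨L * |M - c|, by positivity, fun a ha b hb => ?_⟩
  have h := hL a ha b hb a ha a ha
  rw [powBregman_self hr (hc.trans_le ha.1).le, sub_zero, sub_self, abs_zero, zero_add] at h
  refine (le_abs_self _).trans (h.trans ?_)
  have : |b - a| ≤ |M - c| := by
    rw [abs_of_nonneg (sub_nonneg.2 (ha.1.trans ha.2)), abs_le]
    constructor <;> linarith [ha.1, ha.2, hb.1, hb.2]
  gcongr

lemma integrable_powBregman {ν : Measure E} [IsFiniteMeasure ν] {a b : E → ℝ}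
    (hr : 1 < r) (hc : 0 < c) (ha : Measurable a) (hb : Measurable b)
    (ham : ∀ x, a x ∈ Set.Icc c M) (hbm : ∀ x, b x ∈ Set.Icc c M) :
    Integrable (fun x => powBregman r (a x) (b x)) ν := by
  obtain ⟨K, -, hK⟩ := exists_powBregman_le (M := M) hr hc
  refine Integrable.of_mem_Icc 0 K (measurable_powBregman ha hb).aemeasurable
    (ae_of_all _ fun x => ⟨?_, hK _ (ham x) _ (hbm x)⟩)
  exact powBregman_nonneg hr (hc.trans_le (ham x).1).le (hc.trans_le (hbm x).1).le

/-- Jensen's inequality in two variables: integrate the tangent plane at the pair of means. -/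
lemma powBregman_integral_le {ν : Measure E} [IsProbabilityMeasure ν] {a b : E → ℝ}
    (hr : 1 < r) (hr2 : r ≤ 2) (hc : 0 < c) (ha : Measurable a) (hb : Measurable b)
    (ham : ∀ x, a x ∈ Set.Icc c M) (hbm : ∀ x, b x ∈ Set.Icc c M) :
    powBregman r (∫ x, a x ∂ν) (∫ x, b x ∂ν) ≤ ∫ x, powBregman r (a x) (b x) ∂ν := by
  have ia : Integrable a ν := Integrable.of_mem_Icc c M ha.aemeasurable (ae_of_all _ ham)
  have ib : Integrable b ν := Integrable.of_mem_Icc c M hb.aemeasurable (ae_of_all _ hbm)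
  have h0a := integral_mem_Icc (ν := ν) ha ham
  have h0b := integral_mem_Icc (ν := ν) hb hbm
  set a₀ := ∫ x, a x ∂ν with ha₀
  set b₀ := ∫ x, b x ∂ν with hb₀
  set k := r * (r - 1) * a₀ ^ (r - 2) * (b₀ - a₀)
  set l := r * (b₀ ^ (r - 1) - a₀ ^ (r - 1))
  have i1 : Integrable (fun x => k * (a x - a₀)) ν := (ia.sub (integrable_const _)).const_mul k
  have i2 : Integrable (fun x => l * (b x - b₀)) ν := (ib.sub (integrable_const _)).const_mul l
  have i3 : Integrable (fun x => powBregman r a₀ b₀ - k * (a x - a₀)) ν :=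
    (integrable_const _).sub i1
  have e : ∫ x, (powBregman r a₀ b₀ - k * (a x - a₀) + l * (b x - b₀)) ∂ν = powBregman r a₀ b₀ := by
    rw [integral_add i3 i2, integral_sub (integrable_const _) i1, integral_const_mul,
      integral_const_mul, integral_sub ia (integrable_const _), integral_sub ib (integrable_const _)]
    simp [← ha₀, ← hb₀]
  rw [← e]
  refine integral_mono (i3.add i2) (integrable_powBregman hr hc ha hb ham hbm) fun x => ?_
  exact powBregman_tangent hr hr2 (hc.trans_le (ham x).1).le (hc.trans_le (hbm x).1).le
    (hc.trans_le h0a.1) (hc.trans_le h0b.1).le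

/-- `b ↦ B(a, b)` differs from `b ^ r` by an affine function, which does not change the Jensen gap.
Hence the entropy is the least value of `∫ B(a, g)` over `a`, attained at the mean. -/
lemma powEnt_eq {ν : Measure E} [IsProbabilityMeasure ν] {g : E → ℝ}
    (hr : 1 < r) (hc : 0 < c) (hg : Measurable g) (hgm : ∀ x, g x ∈ Set.Icc c M) (a : ℝ) :
    powEnt r ν g = ∫ x, powBregman r a (g x) ∂ν - powBregman r a (∫ x, g x ∂ν) := by
  have ig : Integrable g ν := Integrable.of_mem_Icc c M hg.aemeasurable (ae_of_all _ hgm)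
  have ir := integrable_rpow_of_mem_Icc (ν := ν) hr hc hg hgm
  have ic : Integrable (fun x => g x ^ r + (r - 1) * a ^ r) ν := ir.add (integrable_const _)
  simp only [powBregman, powEnt]
  rw [integral_sub ic (ig.const_mul _),
    integral_add ir (integrable_const _), integral_const_mul (r * a ^ (r - 1))]
  simp

lemma powEnt_le_integral_powBregman {ν : Measure E} [IsProbabilityMeasure ν] {g : E → ℝ}
    (hr : 1 < r) (hc : 0 < c) (hg : Measurable g) (hgm : ∀ x, g x ∈ Set.Icc c M) {a : ℝ}
    (ha : 0 ≤ a) : powEnt r ν g ≤ ∫ x, powBregman r a (g x) ∂ν := by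
  have h := integral_mem_Icc (ν := ν) hg hgm
  rw [powEnt_eq hr hc hg hgm a]
  linarith [powBregman_nonneg hr ha (hc.trans_le h.1).le]

lemma powEnt_eq_integral_powBregman {ν : Measure E} [IsProbabilityMeasure ν] {g : E → ℝ}
    (hr : 1 < r) (hc : 0 < c) (hg : Measurable g) (hgm : ∀ x, g x ∈ Set.Icc c M) :
    powEnt r ν g = ∫ x, powBregman r (∫ y, g y ∂ν) (g x) ∂ν := by
  have h := integral_mem_Icc (ν := ν) hg hgm
  rw [powEnt_eq hr hc hg hgm (∫ y, g y ∂ν), powBregman_self hr (hc.trans_le h.1).le, sub_zero]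

lemma measurable_integral_left {ν : Measure E₁} [SFinite ν] {g : E₁ × E₂ → ℝ}
    (hg : Measurable g) : Measurable fun y => ∫ x, g (x, y) ∂ν :=
  hg.stronglyMeasurable.integral_prod_left'.measurable

lemma measurable_integral_right {ν : Measure E₂} [SFinite ν] {g : E₁ × E₂ → ℝ}
    (hg : Measurable g) : Measurable fun x => ∫ y, g (x, y) ∂ν :=
  hg.stronglyMeasurable.integral_prod_right'.measurable

/-- Convexity of the entropy. -/
lemma powEnt_integral_le {ν₁ : Measure E₁} {ν₂ : Measure E₂} [IsProbabilityMeasure ν₁]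
    [IsProbabilityMeasure ν₂] {g : E₁ × E₂ → ℝ} (hr : 1 < r) (hr2 : r ≤ 2) (hc : 0 < c)
    (hg : Measurable g) (hgm : ∀ x, g x ∈ Set.Icc c M) :
    powEnt r ν₂ (fun y => ∫ x, g (x, y) ∂ν₁) ≤ ∫ x, powEnt r ν₂ (fun y => g (x, y)) ∂ν₁ := by
  have hl : ∀ y, Measurable fun x => g (x, y) := fun y => hg.comp (by fun_prop)
  have hri : ∀ x, Measurable fun y => g (x, y) := fun y => hg.comp (by fun_prop)
  have mb := measurable_integral_left (ν := ν₁) hg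
  have ma := measurable_integral_right (ν := ν₂) hg
  have hb : ∀ y, ∫ x, g (x, y) ∂ν₁ ∈ Set.Icc c M := fun y => integral_mem_Icc (hl y) fun _ => hgm _
  have ha : ∀ x, ∫ y, g (x, y) ∂ν₂ ∈ Set.Icc c M := fun y => integral_mem_Icc (hri y) fun _ => hgm _
  rw [powEnt_eq_integral_powBregman hr hc mb hb]
  -- With the entropies written as Bregman integrals around the means, the claim is Jensen's
  -- inequality for `B` at the pair (mean of a section, value), for each fixed `y`.
  have e : ∀ x, powEnt r ν₂ (fun y => g (x, y)) =
      ∫ y, powBregman r (∫ y, g (x, y) ∂ν₂) (g (x, y)) ∂ν₂ := fun x =>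
    powEnt_eq_integral_powBregman hr hc (hri x) fun _ => hgm _
  simp_rw [e]
  have ip : Integrable (fun z : E₁ × E₂ => powBregman r (∫ y, g (z.1, y) ∂ν₂) (g z))
      (ν₁.prod ν₂) :=
    integrable_powBregman hr hc (ma.comp measurable_fst) hg (fun z => ha z.1) hgm
  rw [integral_integral_swap (f := fun x y => powBregman r (∫ y, g (x, y) ∂ν₂) (g (x, y))) ip]
  have ig : Integrable g (ν₁.prod ν₂) :=
    Integrable.of_mem_Icc c M hg.aemeasurable (ae_of_all _ hgm)
  have es : ∫ y, ∫ x, g (x, y) ∂ν₁ ∂ν₂ = ∫ x, ∫ y, g (x, y) ∂ν₂ ∂ν₁ :=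
    (integral_integral_swap (f := fun x y => g (x, y)) ig).symm
  rw [es]
  refine integral_mono ?_ ip.integral_prod_right fun y => ?_
  · exact integrable_powBregman hr hc measurable_const mb
      (fun _ => integral_mem_Icc ma ha) hb
  · exact powBregman_integral_le hr hr2 hc ma (hl y) ha fun _ => hgm _

/-- The chain rule: the terms with the `r`-th power of the partial mean telescope. -/
lemma powEnt_prod_eq {ν₁ : Measure E₁} {ν₂ : Measure E₂} [IsProbabilityMeasure ν₁]
    [IsProbabilityMeasure ν₂] {g : E₁ × E₂ → ℝ} (hr : 1 < r) (hc : 0 < c)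
    (hg : Measurable g) (hgm : ∀ x, g x ∈ Set.Icc c M) :
    powEnt r (ν₁.prod ν₂) g = ∫ y, powEnt r ν₁ (fun x => g (x, y)) ∂ν₂ +
      powEnt r ν₂ (fun y => ∫ x, g (x, y) ∂ν₁) := by
  have hl : ∀ y, Measurable fun x => g (x, y) := fun y => hg.comp (by fun_prop)
  have mb := measurable_integral_left (ν := ν₁) hg
  have hb : ∀ y, ∫ x, g (x, y) ∂ν₁ ∈ Set.Icc c M := fun y => integral_mem_Icc (hl y) fun _ => hgm _
  have ig : Integrable g (ν₁.prod ν₂) :=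
    Integrable.of_mem_Icc c M hg.aemeasurable (ae_of_all _ hgm)
  have ir := integrable_rpow_of_mem_Icc (ν := ν₁.prod ν₂) hr hc hg hgm
  simp only [powEnt]
  rw [integral_prod_symm _ ir, integral_prod_symm _ ig, integral_sub ir.integral_prod_right
    (integrable_rpow_of_mem_Icc hr hc mb hb)]
  ring

lemma powEnt_prod_le {ν₁ : Measure E₁} {ν₂ : Measure E₂} [IsProbabilityMeasure ν₁]
    [IsProbabilityMeasure ν₂] {g : E₁ × E₂ → ℝ} (hr : 1 < r) (hr2 : r ≤ 2) (hc : 0 < c)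
    (hg : Measurable g) (hgm : ∀ x, g x ∈ Set.Icc c M) :
    powEnt r (ν₁.prod ν₂) g ≤ ∫ y, powEnt r ν₁ (fun x => g (x, y)) ∂ν₂ +
      ∫ x, powEnt r ν₂ (fun y => g (x, y)) ∂ν₁ := by
  rw [powEnt_prod_eq hr hc hg hgm]
  gcongr
  exact powEnt_integral_le hr hr2 hc hg hgm

lemma integrable_powEnt_left {ν₁ : Measure E₁} {ν₂ : Measure E₂} [IsProbabilityMeasure ν₁]
    [IsProbabilityMeasure ν₂] {g : E₁ × E₂ → ℝ} (hr : 1 < r) (hc : 0 < c)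
    (hg : Measurable g) (hgm : ∀ x, g x ∈ Set.Icc c M) :
    Integrable (fun y => powEnt r ν₁ fun x => g (x, y)) ν₂ := by
  have hl : ∀ y, Measurable fun x => g (x, y) := fun y => hg.comp (by fun_prop)
  have ir := integrable_rpow_of_mem_Icc (ν := ν₁.prod ν₂) hr hc hg hgm
  exact ir.integral_prod_right.sub (integrable_rpow_of_mem_Icc hr hc
    (measurable_integral_left hg) fun y => integral_mem_Icc (hl y) fun _ => hgm _)

end Entropy

/-! ### The entropy inequality for finitely many independent Poisson variables. -/

section Poisson

open scoped NNReal

variable {r c M : ℝ}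

/-- By `exp (-lam) ≥ 1 - lam`, the mass is at most `1 - (1 - lam) (1 + lam)`. -/
lemma poissonMeasure_real_compl_le (lam : ℝ≥0) :
    (poissonMeasure lam).real ({0, 1} : Set ℕ)ᶜ ≤ (lam : ℝ) ^ 2 := by
  rw [probReal_compl_eq_one_sub (by measurability)]
  have : ({0, 1} : Set ℕ) = {0} ∪ {1} := rfl
  rw [this, measureReal_union (by simp) (by measurability), poissonMeasure_real_singleton,
    poissonMeasure_real_singleton]
  have h := Real.add_one_le_exp (-(lam : ℝ))
  have hl : 0 ≤ (lam : ℝ) := lam.2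
  simp
  nlinarith

/-- For a small mean only the values `0` and `1` count. The entropy is bounded by the Bregman
integral around `h 0`: the value `0` contributes nothing, the value `1` gives the jump from `0` to
`1`, and the rest has mass at most `lam ^ 2`. -/
lemma powEnt_poissonMeasure_le_add_sq {K : ℝ} (hr : 1 < r) (hc : 0 < c)
    (hK : ∀ a ∈ Set.Icc c M, ∀ b ∈ Set.Icc c M, powBregman r a b ≤ K) (lam : ℝ≥0)
    {h : ℕ → ℝ} (hm : ∀ k, h k ∈ Set.Icc c M) :
    powEnt r (poissonMeasure lam) h ≤
      lam * ∫ k, powBregman r (h k) (h (k + 1)) ∂(poissonMeasure lam) + K * lam ^ 2 := by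
  have pos : ∀ k, 0 ≤ h k := fun k => (hc.trans_le (hm k).1).le
  refine (powEnt_le_integral_powBregman hr hc .of_discrete hm (pos 0)).trans ?_
  have nn : ∀ i j, 0 ≤ powBregman r (h i) (h j) := fun i j =>
    powBregman_nonneg hr (pos i) (pos j)
  have hK0 : 0 ≤ K := (nn 0 0).trans (hK _ (hm 0) _ (hm 0))
  have i1 : Integrable (fun k => ({1} : Set ℕ).indicator
      (fun _ => powBregman r (h 0) (h 1)) k) (poissonMeasure lam) :=
    (integrable_const _).indicator .of_discrete
  have i2 : Integrable (fun k => ({0, 1}ᶜ : Set ℕ).indicator (fun _ => K) k) (poissonMeasure lam) :=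
    (integrable_const _).indicator .of_discrete
  have s1 : ∫ k, powBregman r (h 0) (h k) ∂(poissonMeasure lam) ≤
      (poissonMeasure lam).real {1} * powBregman r (h 0) (h 1) +
        (poissonMeasure lam).real ({0, 1} : Set ℕ)ᶜ * K := by
    calc _ ≤ ∫ k, (({1} : Set ℕ).indicator (fun _ => powBregman r (h 0) (h 1)) k +
            ({0, 1}ᶜ : Set ℕ).indicator (fun _ => K) k) ∂(poissonMeasure lam) := by
          refine integral_mono ?_ (i1.add i2) fun k => ?_
          · exact integrable_powBregman hr hc measurable_const .of_discrete (fun _ => hm 0) hm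
          · rcases k with _ | _ | k
            · simp [powBregman_self hr (pos 0)]
            · simp
            · simpa using hK _ (hm 0) _ (hm _)
      _ = _ := by
          rw [integral_add i1 i2, integral_indicator_const _ .of_discrete,
            integral_indicator_const _ .of_discrete]
          simp
  have s2 : (poissonMeasure lam).real {0} * powBregman r (h 0) (h 1) ≤
      ∫ k, powBregman r (h k) (h (k + 1)) ∂(poissonMeasure lam) := by
    calc _ = ∫ k, ({0} : Set ℕ).indicator
            (fun _ => powBregman r (h 0) (h 1)) k ∂(poissonMeasure lam) := by
          rw [integral_indicator_const _ .of_discrete]; simp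
      _ ≤ _ := by
          refine integral_mono ((integrable_const _).indicator .of_discrete) ?_ fun k => ?_
          · exact integrable_powBregman hr hc .of_discrete .of_discrete hm fun k => hm _
          · rcases k with _ | k
            · simp
            · simpa using nn _ _
  -- The mass at `1` becomes `lam` times the mass at `0`, so this term is the `k = 0` part of the
  -- desired integral.
  have e : (poissonMeasure lam).real {1} = lam * (poissonMeasure lam).real {0} := by
    rw [poissonMeasure_real_singleton, poissonMeasure_real_singleton]; simp [mul_comm]
  refine s1.trans (add_le_add ?_ ?_)
  · rw [e, mul_assoc]; gcongr
  · rw [mul_comm]; gcongr; exact poissonMeasure_real_compl_le lam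

lemma integral_poissonMeasure_add {lam₁ lam₂ : ℝ≥0} (h : ℕ → ℝ) :
    ∫ k, h k ∂(poissonMeasure (lam₁ + lam₂)) =
      ∫ z, h (z.1 + z.2) ∂((poissonMeasure lam₁).prod (poissonMeasure lam₂)) := by
  rw [← poissonMeasure_conv_poissonMeasure, Measure.conv,
    integral_map (by fun_prop) .of_discrete]

/-- A Poisson variable of mean `2 l` is a sum of two independent ones of mean `l`. By subadditivity
the errors add up to `2 K l ^ 2 / 2 ^ m`, which is `K (2 l) ^ 2 / 2 ^ (m + 1)`: each halving of the
mean halves the error. -/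
lemma powEnt_poissonMeasure_le_add_div {K : ℝ} (hr : 1 < r) (hr2 : r ≤ 2) (hc : 0 < c)
    (hK : ∀ a ∈ Set.Icc c M, ∀ b ∈ Set.Icc c M, powBregman r a b ≤ K) (m : ℕ) (lam : ℝ≥0)
    {h : ℕ → ℝ} (hm : ∀ k, h k ∈ Set.Icc c M) :
    powEnt r (poissonMeasure lam) h ≤
      lam * ∫ k, powBregman r (h k) (h (k + 1)) ∂(poissonMeasure lam) +
        K * lam ^ 2 / 2 ^ m := by
  induction m generalizing lam h with
  | zero => simpa using powEnt_poissonMeasure_le_add_sq hr hc hK lam hm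
  | succ m ih =>
    obtain ⟨l, rfl⟩ : ∃ l, lam = l + l := ⟨lam / 2, (add_halves lam).symm⟩
    have e1 : powEnt r (poissonMeasure (l + l)) h =
        powEnt r ((poissonMeasure l).prod (poissonMeasure l)) (fun z => h (z.1 + z.2)) := by
      simp only [powEnt]
      rw [integral_poissonMeasure_add, integral_poissonMeasure_add]
    rw [e1, integral_poissonMeasure_add]
    have ip : Integrable (fun z : ℕ × ℕ => powBregman r (h (z.1 + z.2)) (h (z.1 + z.2 + 1)))
        ((poissonMeasure l).prod (poissonMeasure l)) :=
      integrable_powBregman hr hc .of_discrete .of_discrete (fun _ => hm _) fun _ => hm _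
    refine (powEnt_prod_le hr hr2 hc .of_discrete fun _ => hm _).trans ?_
    have ie : Integrable (fun y => powEnt r (poissonMeasure l) fun x => h (x + y))
        (poissonMeasure l) :=
      integrable_powEnt_left (g := fun z : ℕ × ℕ => h (z.1 + z.2)) hr hc .of_discrete fun _ => hm _
    have b1 : ∫ y, powEnt r (poissonMeasure l) (fun x => h (x + y)) ∂(poissonMeasure l) ≤
        l * ∫ z : ℕ × ℕ, powBregman r (h (z.1 + z.2)) (h (z.1 + z.2 + 1))
          ∂((poissonMeasure l).prod (poissonMeasure l)) + K * l ^ 2 / 2 ^ m := by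
      calc _ ≤ ∫ y, (l * (∫ x, powBregman r (h (x + y)) (h (x + y + 1)) ∂(poissonMeasure l)) +
            K * l ^ 2 / 2 ^ m) ∂(poissonMeasure l) := by
            refine integral_mono ie
              ((ip.integral_prod_right.const_mul _).add (integrable_const _)) fun y => ?_
            have := ih l (h := fun x => h (x + y)) fun _ => hm _
            simp only [add_right_comm _ 1 y] at this
            exact this
        _ = _ := by
            rw [integral_add (ip.integral_prod_right.const_mul _) (integrable_const _),
              integral_const_mul, integral_prod_symm _ ip]
            simp
    have b2 : ∫ x, powEnt r (poissonMeasure l) (fun y => h (x + y)) ∂(poissonMeasure l) =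
        ∫ y, powEnt r (poissonMeasure l) (fun x => h (x + y)) ∂(poissonMeasure l) := by
      simp_rw [add_comm]
    rw [b2]
    refine (add_le_add b1 b1).trans (le_of_eq ?_)
    rw [pow_succ]
    push_cast
    field_simp
    ring

lemma powEnt_poissonMeasure_le (hr : 1 < r) (hr2 : r ≤ 2) (hc : 0 < c) (lam : ℝ≥0)
    {h : ℕ → ℝ} (hm : ∀ k, h k ∈ Set.Icc c M) :
    powEnt r (poissonMeasure lam) h ≤
      lam * ∫ k, powBregman r (h k) (h (k + 1)) ∂(poissonMeasure lam) := by
  obtain ⟨K, -, hK⟩ := exists_powBregman_le (M := M) hr hc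
  have ht : Filter.Tendsto (fun m : ℕ => lam * ∫ k, powBregman r (h k) (h (k + 1))
      ∂(poissonMeasure lam) + K * (lam : ℝ) ^ 2 / 2 ^ m) Filter.atTop
      (nhds (lam * ∫ k, powBregman r (h k) (h (k + 1)) ∂(poissonMeasure lam) + 0)) := by
    refine tendsto_const_nhds.add ?_
    simp_rw [div_eq_mul_inv, ← inv_pow]
    simpa using (tendsto_pow_atTop_nhds_zero_of_lt_one (r := (2 : ℝ)⁻¹) (by norm_num)
      (by norm_num)).const_mul (K * (lam : ℝ) ^ 2)
  rw [add_zero] at ht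
  exact ge_of_tendsto' ht fun m => powEnt_poissonMeasure_le_add_div hr hr2 hc hK m lam hm

/-- The law of a family of independent Poisson variables. -/
noncomputable abbrev piPoisson {J : Type*} [Fintype J] (lam : J → ℝ≥0) : Measure (J → ℕ) :=
  Measure.pi fun i => poissonMeasure (lam i)

/-- Induction on the number of coordinates: subadditivity splits off the first one, to which the
one-dimensional inequality applies. -/
lemma powEnt_piPoisson_fin_le (hr : 1 < r) (hr2 : r ≤ 2) (hc : 0 < c) {n : ℕ} (lam : Fin n → ℝ≥0)
    {h : (Fin n → ℕ) → ℝ} (hm : ∀ k, h k ∈ Set.Icc c M) :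
    powEnt r (piPoisson lam) h ≤
      ∑ i, lam i * ∫ k, powBregman r (h k) (h (k + Pi.single i 1)) ∂(piPoisson lam) := by
  induction n with
  | zero =>
    have : h = fun _ => h 0 := funext fun k => congrArg h (Subsingleton.elim _ _)
    rw [this]
    simp [powEnt]
  | succ n ih =>
    set e := MeasurableEquiv.piFinSuccAbove (fun _ : Fin (n + 1) => ℕ) 0 with he
    have mp : MeasurePreserving e (piPoisson lam)
        ((poissonMeasure (lam 0)).prod (piPoisson fun j => lam j.succ)) :=
      measurePreserving_piFinSuccAbove (fun i => poissonMeasure (lam i)) 0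
    have hint : ∀ u : (Fin (n + 1) → ℕ) → ℝ, ∫ k, u k ∂(piPoisson lam) =
        ∫ z, u (e.symm z) ∂((poissonMeasure (lam 0)).prod (piPoisson fun j => lam j.succ)) := by
      intro u
      rw [← mp.integral_comp']
      simp
    have e0 : ∀ k l, e.symm (k, l) + Pi.single 0 1 = e.symm (k + 1, l) := by
      intro k l
      ext i
      refine Fin.cases ?_ (fun j => ?_) i <;>
        simp [he, MeasurableEquiv.piFinSuccAbove, Fin.insertNthEquiv]
    have e1 : ∀ k l j, e.symm (k, l) + Pi.single (Fin.succ j) 1 =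
        e.symm (k, l + Pi.single j 1) := by
      intro k l j
      ext i
      refine Fin.cases ?_ (fun j' => ?_) i
      · simp [he, MeasurableEquiv.piFinSuccAbove, Fin.insertNthEquiv]
      · simp [he, MeasurableEquiv.piFinSuccAbove, Fin.insertNthEquiv, Pi.single_apply]
    have eE : powEnt r (piPoisson lam) h =
        powEnt r ((poissonMeasure (lam 0)).prod (piPoisson fun j => lam j.succ))
          (fun z => h (e.symm z)) := by
      simp only [powEnt, hint]
    have ip : ∀ i, Integrable (fun z => powBregman r (h (e.symm z)) (h (e.symm z + Pi.single i 1)))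
        ((poissonMeasure (lam 0)).prod (piPoisson fun j => lam j.succ)) := fun i =>
      integrable_powBregman hr hc .of_discrete .of_discrete (fun _ => hm _) fun _ => hm _
    rw [eE, Fin.sum_univ_succ]
    refine (powEnt_prod_le hr hr2 hc .of_discrete fun _ => hm _).trans (add_le_add ?_ ?_)
    · rw [hint, integral_prod_symm _ (ip 0), ← integral_const_mul]
      refine integral_mono ?_ ((ip 0).integral_prod_right.const_mul _) fun l => ?_
      · exact integrable_powEnt_left hr hc .of_discrete fun _ => hm _
      · simp only [e0]
        exact powEnt_poissonMeasure_le hr hr2 hc (lam 0) fun k => hm _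
    · simp_rw [hint]
      have : ∀ j : Fin n, lam j.succ * ∫ z, powBregman r (h (e.symm z))
          (h (e.symm z + Pi.single j.succ 1))
            ∂((poissonMeasure (lam 0)).prod (piPoisson fun j => lam j.succ)) =
          ∫ k, lam j.succ * (∫ l, powBregman r (h (e.symm (k, l)))
            (h (e.symm (k, l) + Pi.single j.succ 1)) ∂(piPoisson fun j => lam j.succ))
            ∂(poissonMeasure (lam 0)) := by
        intro j
        rw [integral_prod _ (ip j.succ), integral_const_mul]
      simp_rw [this]
      rw [← integral_finsetSum _ fun j _ => ((ip j.succ).integral_prod_left.const_mul _)]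
      refine integral_mono ?_ (integrable_finsetSum _ fun j _ =>
        ((ip j.succ).integral_prod_left.const_mul _)) fun k => ?_
      · exact integrable_powEnt_left (g := fun z : (Fin n → ℕ) × ℕ => h (e.symm (z.2, z.1)))
          hr hc .of_discrete fun _ => hm _
      · simp only [e1]
        exact ih (fun j => lam j.succ) fun l => hm _

lemma powEnt_piPoisson_le (hr : 1 < r) (hr2 : r ≤ 2) (hc : 0 < c) {J : Type*} [Fintype J]
    [DecidableEq J] (lam : J → ℝ≥0) {h : (J → ℕ) → ℝ} (hm : ∀ k, h k ∈ Set.Icc c M) :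
    powEnt r (piPoisson lam) h ≤
      ∑ i, lam i * ∫ k, powBregman r (h k) (h (k + Pi.single i 1)) ∂(piPoisson lam) := by
  let f := (Fintype.equivFin J).symm
  set e := MeasurableEquiv.piCongrLeft (fun _ : J => ℕ) f with he
  have mp : MeasurePreserving e (piPoisson fun i => lam (f i)) (piPoisson lam) :=
    measurePreserving_piCongrLeft (fun i => poissonMeasure (lam i)) f
  have hint : ∀ u : (J → ℕ) → ℝ, ∫ k, u k ∂(piPoisson lam) =
      ∫ z, u (e z) ∂(piPoisson fun i => lam (f i)) := fun u => (mp.integral_comp' u).symm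
  have hs : ∀ k i, e k + Pi.single (f i) 1 = e (k + Pi.single i 1) := by
    intro k i
    ext j
    obtain ⟨j, rfl⟩ := f.surjective j
    have : ∀ l : Fin (Fintype.card J) → ℕ, e l (f j) = l j := fun l =>
      Equiv.piCongrLeft_apply_apply (fun _ : J => ℕ) f l j
    rw [Pi.add_apply, this, this, Pi.add_apply]
    simp [Pi.single_apply]
  have := powEnt_piPoisson_fin_le hr hr2 hc (fun i => lam (f i)) (h := fun k => h (e k))
    fun _ => hm _
  rw [← f.sum_comp]
  simp only [powEnt, hint, hs] at this ⊢
  exact this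

/-- An entropy bound with the jumps in a part of the coordinates only, for functions that depend
little on the others. -/
lemma powEnt_piPoisson_le_of_approx {L : ℝ} (hr : 1 < r) (hr2 : r ≤ 2) (hc : 0 < c)
    (hL : ∀ a ∈ Set.Icc c M, ∀ b ∈ Set.Icc c M, |a ^ r - b ^ r| ≤ L * |a - b|) (hL0 : 0 ≤ L)
    {n : ℕ} (lam : Fin n → ℝ≥0) (p : Fin n → Prop) [DecidablePred p]
    {h h₀ : (Fin n → ℕ) → ℝ} (hm : ∀ k, h k ∈ Set.Icc c M) (hm₀ : ∀ k, h₀ k ∈ Set.Icc c M)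
    (hp : ∀ k k', (∀ i, p i → k i = k' i) → h₀ k = h₀ k') :
    powEnt r (piPoisson lam) h ≤ 2 * L * ∫ k, |h k - h₀ k| ∂(piPoisson lam) +
      ∑ i with p i, lam i * ∫ k, powBregman r (h k) (h (k + Pi.single i 1)) ∂(piPoisson lam) := by
  set e := MeasurableEquiv.piEquivPiSubtypeProd (fun _ : Fin n => ℕ) p with he
  set ν₁ := piPoisson fun i : {i // p i} => lam i
  set ν₂ := piPoisson fun i : {i // ¬ p i} => lam i
  have mp : MeasurePreserving e (piPoisson lam) (ν₁.prod ν₂) :=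
    measurePreserving_piEquivPiSubtypeProd (fun i => poissonMeasure (lam i)) p
  have hint : ∀ u : (Fin n → ℕ) → ℝ, ∫ k, u k ∂(piPoisson lam) =
      ∫ z, u (e.symm z) ∂(ν₁.prod ν₂) := by
    intro u
    rw [← mp.integral_comp']
    simp
  have es : ∀ k l (i : {i // p i}), e.symm (k, l) + Pi.single i.1 1 =
      e.symm (k + Pi.single i 1, l) := by
    intro k l i
    ext j
    by_cases hj : p j
    · simp [he, MeasurableEquiv.piEquivPiSubtypeProd, Equiv.piEquivPiSubtypeProd, hj,
        Pi.single_apply, Subtype.ext_iff]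
    · have : j ≠ i.1 := fun h => hj (h ▸ i.2)
      simp [he, MeasurableEquiv.piEquivPiSubtypeProd, Equiv.piEquivPiSubtypeProd, hj,
        this]
  have e0 : ∀ k l l', h₀ (e.symm (k, l)) = h₀ (e.symm (k, l')) := by
    intro k l l'
    refine hp _ _ fun i hi => ?_
    simp [he, MeasurableEquiv.piEquivPiSubtypeProd, Equiv.piEquivPiSubtypeProd, hi]
  set g : ({i // p i} → ℕ) × ({i // ¬ p i} → ℕ) → ℝ := fun z => h (e.symm z) with hg
  set g₀ : ({i // p i} → ℕ) × ({i // ¬ p i} → ℕ) → ℝ := fun z => h₀ (e.symm z) with hg₀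
  have gm : ∀ z, g z ∈ Set.Icc c M := fun z => hm _
  have gm₀ : ∀ z, g₀ z ∈ Set.Icc c M := fun z => hm₀ _
  have eE : powEnt r (piPoisson lam) h = powEnt r (ν₂.prod ν₁) (fun z => g z.swap) := by
    simp only [powEnt, hint]
    rw [← integral_prod_swap (fun z => g z ^ r), ← integral_prod_swap g]
  -- Chain rule: the mean entropy in the coordinates outside `p`, plus the entropy of the average
  -- over them. The first part is small because `h₀` is constant in those coordinates; the second is
  -- handled by convexity and the inequality for the coordinates in `p`.
  rw [eE, powEnt_prod_eq hr hc .of_discrete fun _ => gm _]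
  have ig : Integrable g (ν₁.prod ν₂) := Integrable.of_mem_Icc c M
    Measurable.of_discrete.aemeasurable (ae_of_all _ gm)
  have ig₀ : Integrable g₀ (ν₁.prod ν₂) := Integrable.of_mem_Icc c M
    Measurable.of_discrete.aemeasurable (ae_of_all _ gm₀)
  have igs : ∀ k, Integrable (fun l => g (k, l)) ν₂ := fun k => Integrable.of_mem_Icc c M
    Measurable.of_discrete.aemeasurable (ae_of_all _ fun _ => gm _)
  have igs₀ : ∀ k, Integrable (fun l => g₀ (k, l)) ν₂ := fun k => Integrable.of_mem_Icc c M
    Measurable.of_discrete.aemeasurable (ae_of_all _ fun _ => gm₀ _)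
  have ia : Integrable (fun z => |g z - g₀ z|) (ν₁.prod ν₂) := (ig.sub ig₀).abs
  have ias : ∀ k, Integrable (fun l => |g (k, l) - g₀ (k, l)|) ν₂ := fun k =>
    ((igs k).sub (igs₀ k)).abs
  refine add_le_add ?_ ?_
  · rw [hint, integral_prod _ ia, ← integral_const_mul]
    refine integral_mono ?_ (ia.integral_prod_left.const_mul _) fun k => ?_
    · exact integrable_powEnt_left hr hc .of_discrete fun _ => gm _
    · have hbar : ∫ l, g (k, l) ∂ν₂ ∈ Set.Icc c M := integral_mem_Icc .of_discrete fun _ => gm _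
      have i1 := integrable_rpow_of_mem_Icc (ν := ν₂) (g := fun l => g (k, l)) hr hc .of_discrete
        fun _ => gm _
      set b := ∫ l, g (k, l) ∂ν₂ with hb
      -- The value `0` is arbitrary, as `g₀ (k, ·)` is constant. Comparing both `g (k, l)` and its
      -- mean with this constant accounts for the factor `2`.
      have hb0 : |b - g₀ (k, 0)| ≤ ∫ l, |g (k, l) - g₀ (k, l)| ∂ν₂ := by
        have e2 : b - g₀ (k, 0) = ∫ l, (g (k, l) - g₀ (k, l)) ∂ν₂ := by
          have : ∀ l, g₀ (k, l) = g₀ (k, 0) := fun l => e0 k l 0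
          simp_rw [this]
          rw [integral_sub (igs k) (integrable_const _)]
          simp [hb]
        rw [e2]
        exact abs_integral_le_integral_abs
      have i3 : Integrable (fun l => L * (|g (k, l) - g₀ (k, l)| + |b - g₀ (k, 0)|)) ν₂ :=
        ((ias k).add (integrable_const _)).const_mul L
      calc powEnt r ν₂ (fun l => g (k, l)) = ∫ l, (g (k, l) ^ r - b ^ r) ∂ν₂ := by
            rw [integral_sub i1 (integrable_const _)]
            simp [powEnt, hb]
        _ ≤ ∫ l, L * (|g (k, l) - g₀ (k, l)| + |b - g₀ (k, 0)|) ∂ν₂ := by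
            refine integral_mono (i1.sub (integrable_const _)) i3 fun l => ?_
            refine (le_abs_self _).trans ((hL _ (gm _) _ hbar).trans ?_)
            refine mul_le_mul_of_nonneg_left ?_ hL0
            have : g₀ (k, l) = g₀ (k, 0) := e0 k l 0
            have t := abs_sub_le (g (k, l)) (g₀ (k, l)) b
            rw [this] at t ⊢
            rwa [abs_sub_comm b]
        _ = L * (∫ l, |g (k, l) - g₀ (k, l)| ∂ν₂ + |b - g₀ (k, 0)|) := by
            rw [integral_const_mul, integral_add (ias k) (integrable_const _)]
            simp
        _ ≤ L * (∫ l, |g (k, l) - g₀ (k, l)| ∂ν₂ + ∫ l, |g (k, l) - g₀ (k, l)| ∂ν₂) := by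
            gcongr
        _ = _ := by ring
  · refine (powEnt_integral_le hr hr2 hc .of_discrete fun _ => gm _).trans ?_
    have ip : ∀ i : {i // p i}, Integrable (fun z => powBregman r (h (e.symm z))
        (h (e.symm z + Pi.single i.1 1))) (ν₁.prod ν₂) := fun i =>
      integrable_powBregman hr hc .of_discrete .of_discrete (fun _ => hm _) fun _ => hm _
    rw [Finset.sum_subtype (p := p) (Finset.univ.filter p) (by simp)]
    have e2 : ∀ i : {i // p i}, lam i * ∫ k, powBregman r (h k) (h (k + Pi.single i.1 1))
          ∂(piPoisson lam) =
        ∫ l, lam i * (∫ k, powBregman r (h (e.symm (k, l)))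
            (h (e.symm (k, l) + Pi.single i.1 1)) ∂ν₁) ∂ν₂ := by
      intro i
      rw [hint, integral_prod_symm _ (ip i), integral_const_mul]
    simp_rw [e2]
    rw [← integral_finsetSum _ fun i _ => ((ip i).integral_prod_right.const_mul _)]
    refine integral_mono ?_ (integrable_finsetSum _ fun i _ =>
        ((ip i).integral_prod_right.const_mul _)) fun l => ?_
    · exact integrable_powEnt_left hr hc .of_discrete fun _ => gm _
    · simp only [es]
      exact powEnt_piPoisson_le hr hr2 hc (fun i : {i // p i} => lam i) fun k => hm _

/-- The Mecke formula for the Poisson distribution. -/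
lemma lintegral_mul_poissonMeasure (lam : ℝ≥0) (h : ℕ → ℝ≥0∞) :
    ∫⁻ k, k * h k ∂(poissonMeasure lam) = lam * ∫⁻ k, h (k + 1) ∂(poissonMeasure lam) := by
  have e : ∀ u : ℕ → ℝ≥0∞, ∫⁻ k, u k ∂(poissonMeasure lam) =
      ∑' n, ENNReal.ofReal (Real.exp (-lam) * lam ^ n / n.factorial) * u n := by
    intro u
    simp [poissonMeasure]
  rw [e, e, tsum_eq_zero_add' ENNReal.summable, ← ENNReal.tsum_mul_left]
  simp only [Nat.cast_zero, zero_mul, mul_zero, zero_add]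
  refine tsum_congr fun n => ?_
  rw [← mul_assoc, ← mul_assoc]
  congr 1
  rw [show (lam : ℝ≥0∞) = ENNReal.ofReal lam from (ENNReal.ofReal_coe_nnreal).symm,
    show ((n + 1 : ℕ) : ℝ≥0∞) = ENNReal.ofReal ((n + 1 : ℕ) : ℝ) from
      (ENNReal.ofReal_natCast _).symm,
    ← ENNReal.ofReal_mul (by positivity), ← ENNReal.ofReal_mul (by positivity)]
  congr 1
  rw [Nat.factorial_succ, pow_succ]
  push_cast
  field_simp

lemma lintegral_mul_piPoisson {n : ℕ} (lam : Fin n → ℝ≥0) (i : Fin n) (h : (Fin n → ℕ) → ℝ≥0∞) :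
    ∫⁻ k, k i * h k ∂(piPoisson lam) = lam i * ∫⁻ k, h (k + Pi.single i 1) ∂(piPoisson lam) := by
  obtain _ | n := n
  · exact i.elim0
  set e := MeasurableEquiv.piFinSuccAbove (fun _ : Fin (n + 1) => ℕ) i with he
  set ν₂ := piPoisson fun j => lam (i.succAbove j)
  have mp : MeasurePreserving e (piPoisson lam) ((poissonMeasure (lam i)).prod ν₂) :=
    measurePreserving_piFinSuccAbove (fun i => poissonMeasure (lam i)) i
  have hint : ∀ u : (Fin (n + 1) → ℕ) → ℝ≥0∞, ∫⁻ k, u k ∂(piPoisson lam) =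
      ∫⁻ l, ∫⁻ k, u (e.symm (k, l)) ∂(poissonMeasure (lam i)) ∂ν₂ := by
    intro u
    rw [← lintegral_prod_symm' (fun z => u (e.symm z)) .of_discrete,
      ← mp.lintegral_comp_emb e.measurableEmbedding]
    simp
  have e0 : ∀ k l, e.symm (k, l) + Pi.single i 1 = e.symm (k + 1, l) := by
    intro k l
    ext j
    refine Fin.succAboveCases i ?_ (fun j => ?_) j
    · simp [he, MeasurableEquiv.piFinSuccAbove, Fin.insertNthEquiv]
    · simp [he, MeasurableEquiv.piFinSuccAbove, Fin.insertNthEquiv]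
  have e1 : ∀ k l, e.symm (k, l) i = k := by
    intro k l
    simp [he, MeasurableEquiv.piFinSuccAbove, Fin.insertNthEquiv]
  simp_rw [hint, e0, e1]
  rw [← lintegral_const_mul' _ _ (by simp)]
  exact lintegral_congr fun l => lintegral_mul_poissonMeasure (lam i) fun k => h (e.symm (k, l))

end Poisson

/-! ### Measurability on the space of counting measures, and grids of disjoint cells. -/

namespace CountingMeasure

variable {X : Type*} [MeasurableSpace X]

lemma measurable_eval {B : Set X} (hB : MeasurableSet B) :
    Measurable fun ξ : CountingMeasure X => ξ.1 B :=
  (Measure.measurable_coe hB).comp measurable_subtype_coe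

lemma measurable_of_measurable_eval {E : Type*} {mE : MeasurableSpace E}
    {T : E → CountingMeasure X}
    (hT : ∀ B, MeasurableSet B → Measurable fun z => (T z).1 B) : Measurable T :=
  Measurable.subtype_mk (Measure.measurable_of_measurable_coe (fun z => (T z).1) hT)

lemma measurable_add : Measurable fun z : CountingMeasure X × X => z.1.add z.2 := by
  refine measurable_of_measurable_eval fun B hB => ?_
  have : (fun z : CountingMeasure X × X => (z.1.add z.2).1 B) =
      fun z => z.1.1 B + B.indicator 1 z.2 := by
    funext z
    simp [add, Measure.dirac_apply' _ hB]
  rw [this]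
  exact ((measurable_eval hB).comp measurable_fst).add
    ((measurable_one.indicator hB).comp measurable_snd)

lemma add_apply (ξ : CountingMeasure X) (x : X) {B : Set X} (hB : MeasurableSet B) :
    (ξ.add x).1 B = ξ.1 B + B.indicator 1 x := by
  simp [add, Measure.dirac_apply' _ hB]

end CountingMeasure

/-- The measurable sets of finite measure. -/
abbrev FiniteSet {X : Type*} [MeasurableSpace X] (μ : Measure X) : Type _ :=
  {A : Set X // MeasurableSet A ∧ μ A ≠ ∞}

/-- A natural number in `[0, ∞]`, as a natural number. -/
noncomputable def natPart (t : ℝ≥0∞) : ℕ := ⌊t.toReal⌋₊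

lemma natPart_natCast (n : ℕ) : natPart n = n := by simp [natPart]

lemma measurable_natPart : Measurable natPart := Nat.measurable_floor.comp ENNReal.measurable_toReal

section Grid

variable {X : Type*} [MeasurableSpace X] {μ : Measure X}

/-- A family of pairwise disjoint sets that generates the sets in `s`. -/
structure IsGrid (s : Finset (FiniteSet μ)) {n : ℕ} (B : Fin n → FiniteSet μ) : Prop where
  disjoint : Pairwise fun i j => Disjoint (B i).1 (B j).1
  subset_iUnion : ∀ A ∈ s, ∀ x ∈ A.1, ∃ i, (B i).1 ⊆ A.1 ∧ x ∈ (B i).1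

/-- The cells are the atoms of the family: for each nonempty subfamily `t`, the points lying in
exactly those sets of `s` that belong to `t`. Nonemptiness of `t` ensures finite measure. -/
lemma exists_isGrid (s : Finset (FiniteSet μ)) :
    ∃ (n : ℕ) (B : Fin n → FiniteSet μ), IsGrid s B := by
  classical
  let J := {t : Finset (FiniteSet μ) // t ∈ s.powerset ∧ t.Nonempty}
  have : Fintype J := Fintype.subtype (s.powerset.filter Finset.Nonempty) (by simp)
  let cell : J → Set X := fun t => {x | ∀ A ∈ s, x ∈ A.1 ↔ A ∈ t.1}
  have hcell : ∀ t : J, ∀ A ∈ t.1, cell t ⊆ A.1 := fun t A hA x hx =>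
    (hx A (Finset.mem_powerset.1 t.2.1 hA)).2 hA
  have hm : ∀ t, MeasurableSet (cell t) := by
    intro t
    have : cell t = ⋂ A ∈ s, {x | x ∈ A.1 ↔ A ∈ t.1} := by ext; simp [cell]
    rw [this]
    refine Finset.measurableSet_biInter _ fun A _ => ?_
    by_cases h : A ∈ t.1
    · simp only [h, iff_true]
      exact A.2.1
    · simp only [h, iff_false]
      exact A.2.1.compl
  have hf : ∀ t, μ (cell t) ≠ ∞ := by
    intro t
    obtain ⟨A, hA⟩ := t.2.2
    exact ne_top_of_le_ne_top A.2.2 (measure_mono (hcell t A hA))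
  let e := (Fintype.equivFin J).symm
  refine ⟨Fintype.card J, fun i => ⟨cell (e i), hm _, hf _⟩, ⟨?_, ?_⟩⟩
  · intro i j hij
    rw [Set.disjoint_left]
    intro x hx hy
    refine hij (e.injective (Subtype.ext (Finset.ext fun A => ?_)))
    constructor
    · intro hA
      have hs := Finset.mem_powerset.1 (e i).2.1 hA
      exact (hy A hs).1 ((hx A hs).2 hA)
    · intro hA
      have hs := Finset.mem_powerset.1 (e j).2.1 hA
      exact (hx A hs).1 ((hy A hs).2 hA)
  · intro A hA x hx
    have hn : (s.filter fun A => x ∈ A.1).Nonempty := ⟨A, by simp [hA, hx]⟩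
    let t : J := ⟨s.filter fun A => x ∈ A.1, by simp, hn⟩
    refine ⟨e.symm t, ?_, ?_⟩
    · simp only [Equiv.apply_symm_apply]
      exact hcell t A (by simp [t, hA, hx])
    · simp only [Equiv.apply_symm_apply]
      intro A' hA'
      simp [t, hA']

variable {s : Finset (FiniteSet μ)} {n : ℕ} {B : Fin n → FiniteSet μ}

open Classical in
lemma IsGrid.biUnion_eq (hB : IsGrid s B) {A : FiniteSet μ} (hA : A ∈ s) :
    ⋃ i ∈ Finset.univ.filter fun i => (B i).1 ⊆ A.1, (B i).1 = A.1 := by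
  ext x
  simp only [Finset.mem_filter, Finset.mem_univ, true_and, Set.mem_iUnion, exists_prop]
  constructor
  · rintro ⟨i, hi, hx⟩
    exact hi hx
  · exact hB.subset_iUnion A hA x

open Classical in
lemma IsGrid.measure_eq (hB : IsGrid s B) {A : FiniteSet μ} (hA : A ∈ s) (ν : Measure X) :
    ν A.1 = ∑ i with (B i).1 ⊆ A.1, ν (B i).1 := by
  rw [← measure_biUnion_finset (fun i _ j _ hij => hB.disjoint hij) fun i _ => (B i).2.1,
    hB.biUnion_eq hA]

/-- The numbers of points in the cells of a grid. -/
noncomputable def gridCount (B : Fin n → FiniteSet μ) (ξ : CountingMeasure X) : Fin n → ℕ :=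
  fun i => natPart (ξ.1 (B i).1)

lemma measurable_gridCount (B : Fin n → FiniteSet μ) : Measurable (gridCount B) :=
  measurable_pi_lambda _ fun i =>
    measurable_natPart.comp (CountingMeasure.measurable_eval (B i).2.1)

open Classical in
/-- The numbers of points in the sets of `s`, from the numbers of points in the cells of a grid. -/
noncomputable def gridEval (s : Finset (FiniteSet μ)) (B : Fin n → FiniteSet μ) (k : Fin n → ℕ)
    (A : s) : ℝ≥0∞ :=
  ∑ i with (B i).1 ⊆ A.1.1, (k i : ℝ≥0∞)

/-- The numbers of points in the sets of `s`. -/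
def evalOn (s : Finset (FiniteSet μ)) (ξ : CountingMeasure X) (A : s) : ℝ≥0∞ := ξ.1 A.1.1

lemma measurable_evalOn (s : Finset (FiniteSet μ)) : Measurable (evalOn s) :=
  measurable_pi_lambda _ fun A => CountingMeasure.measurable_eval A.1.2.1

lemma IsGrid.evalOn_eq (hB : IsGrid s B) {ξ : CountingMeasure X}
    (hξ : ∀ i, ξ.1 (B i).1 = natPart (ξ.1 (B i).1)) :
    evalOn s ξ = gridEval s B (gridCount B ξ) := by
  classical
  funext A
  rw [evalOn, hB.measure_eq A.2, gridEval]
  exact Finset.sum_congr rfl fun i _ => hξ i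

/-- This identifies adding a point to the process with a unit step in one coordinate of the Poisson
vector. -/
lemma IsGrid.evalOn_add_eq (hB : IsGrid s B) {ξ : CountingMeasure X}
    (hξ : ∀ i, ξ.1 (B i).1 = natPart (ξ.1 (B i).1)) {i : Fin n} {x : X} (hx : x ∈ (B i).1) :
    evalOn s (ξ.add x) = gridEval s B (gridCount B ξ + Pi.single i 1) := by
  classical
  funext A
  rw [evalOn, hB.measure_eq A.2, gridEval]
  refine Finset.sum_congr rfl fun j _ => ?_
  rw [CountingMeasure.add_apply _ _ (B j).2.1, hξ j]
  by_cases hij : j = i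
  · subst hij
    simp [hx, gridCount]
  · have : x ∉ (B j).1 := fun h => Set.disjoint_left.1 (hB.disjoint hij) h hx
    simp [this, hij, gridCount]

end Grid

/-! ### The law of the counts in the cells. -/

section Law

open scoped NNReal

variable {X : Type*} [MeasurableSpace X] {μ : Measure X} {Q : Measure (CountingMeasure X)}

/-- Everything is carried out under the law of `η`, on the space of counting measures itself. -/
lemma IsPoissonProcess.map_id {Ω : Type*} [MeasurableSpace Ω] {P : Measure Ω}
    [IsProbabilityMeasure P] {η : Ω → CountingMeasure X} (hη : IsPoissonProcess P μ η) :
    IsPoissonProcess (P.map η) μ id := by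
  have hm := hη.measurable
  have := Measure.isProbabilityMeasure_map (μ := P) hm.aemeasurable
  refine ⟨measurable_id, fun B hB h => ?_, fun B hB h => ?_, fun n B hB hd => ?_⟩
  · rw [← hη.law_of_ne_top B hB h]
    exact Measure.map_map (CountingMeasure.measurable_eval hB) hm
  · rw [ae_map_iff hm.aemeasurable]
    · exact hη.law_of_eq_top B hB h
    · exact (CountingMeasure.measurable_eval hB) (measurableSet_singleton ∞)
  · have h1 := hη.indep n B hB hd
    have me : ∀ i, Measurable fun ξ : CountingMeasure X => ξ.1 (B i) := fun i =>
      CountingMeasure.measurable_eval (hB i)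
    have h2 := (iIndepFun_iff_map_fun_eq_pi_map fun i => ((me i).comp hm).aemeasurable).1 h1
    refine (iIndepFun_iff_map_fun_eq_pi_map fun i => (me i).aemeasurable).2 ?_
    have : ∀ i, (P.map η).map (fun ξ => ξ.1 (B i)) = P.map fun ω => (η ω).1 (B i) := fun i =>
      Measure.map_map (me i) hm
    simp only [this]
    exact (Measure.map_map (measurable_pi_lambda _ me) hm).trans h2

lemma IsPoissonProcess.ae_eq_natPart (hQ : IsPoissonProcess Q μ id) (B : FiniteSet μ) :
    ∀ᵐ ξ ∂Q, ξ.1 B.1 = (natPart (ξ.1 B.1) : ℝ≥0∞) := by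
  have h := hQ.law_of_ne_top B.1 B.2.1 B.2.2
  have hms : MeasurableSet {t : ℝ≥0∞ | t = natPart t} :=
    measurableSet_eq_fun measurable_id (measurable_from_nat.comp measurable_natPart)
  have h2 : ∀ᵐ t ∂(Q.map fun ξ => ξ.1 B.1), t ∈ {t : ℝ≥0∞ | t = natPart t} := by
    have h' : Q.map (fun ξ => ξ.1 B.1) = _ := h
    rw [h']
    refine (ae_map_iff (by fun_prop) hms).2 (ae_of_all _ fun n => ?_)
    simp [natPart_natCast]
  exact (ae_map_iff (CountingMeasure.measurable_eval B.2.1).aemeasurable hms).1 h2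

lemma IsPoissonProcess.map_natPart (hQ : IsPoissonProcess Q μ id) (B : FiniteSet μ) :
    Q.map (fun ξ => natPart (ξ.1 B.1)) = poissonMeasure (μ B.1).toNNReal := by
  have h : Q.map (fun ξ => ξ.1 B.1) = _ := hQ.law_of_ne_top B.1 B.2.1 B.2.2
  have h2 := congrArg (Measure.map natPart) h
  rw [Measure.map_map measurable_natPart (CountingMeasure.measurable_eval B.2.1),
    Measure.map_map measurable_natPart (by fun_prop)] at h2
  have : natPart ∘ (fun n : ℕ => (n : ℝ≥0∞)) = id := funext natPart_natCast
  rw [this, Measure.map_id] at h2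
  exact h2

lemma IsPoissonProcess.map_gridCount [IsProbabilityMeasure Q] (hQ : IsPoissonProcess Q μ id)
    {s : Finset (FiniteSet μ)} {n : ℕ} {B : Fin n → FiniteSet μ}
    (hB : IsGrid s B) :
    Q.map (gridCount B) = piPoisson fun i => (μ (B i).1).toNNReal := by
  have h := (hQ.indep n (fun i => (B i).1) (fun i => (B i).2.1) hB.disjoint).comp
    (fun _ => natPart) fun _ => measurable_natPart
  have h2 := (iIndepFun_iff_map_fun_eq_pi_map fun i => (measurable_natPart.comp
    (CountingMeasure.measurable_eval (B i).2.1)).aemeasurable).1 h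
  refine h2.trans ?_
  rw [piPoisson]
  congr 1
  funext i
  exact hQ.map_natPart (B i)

open Classical in
/-- Integration over the points of a set `C` and over the process, for functions that depend on
the numbers of points in the cells of a grid. -/
lemma IsPoissonProcess.lintegral_grid [IsProbabilityMeasure Q] (hQ : IsPoissonProcess Q μ id)
    {s : Finset (FiniteSet μ)} {n : ℕ}
    {B : Fin n → FiniteSet μ} (hB : IsGrid s B) {C : FiniteSet μ} (hC : C ∈ s)
    {Φ : CountingMeasure X → X → ℝ≥0∞} {φ : Fin n → (Fin n → ℕ) → ℝ≥0∞}
    (h : ∀ ξ : CountingMeasure X, (∀ i, ξ.1 (B i).1 = natPart (ξ.1 (B i).1)) →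
      ∀ i, ∀ x ∈ (B i).1, Φ ξ x = φ i (gridCount B ξ)) :
    ∫⁻ ξ, ∫⁻ x in C.1, Φ ξ x ∂μ ∂Q = ∑ i with (B i).1 ⊆ C.1, ((μ (B i).1).toNNReal : ℝ≥0∞) *
      ∫⁻ k, φ i k ∂(piPoisson fun i => (μ (B i).1).toNNReal) := by
  rw [← hQ.map_gridCount hB]
  have e1 : ∀ᵐ ξ ∂Q, ∫⁻ x in C.1, Φ ξ x ∂μ =
      ∑ i with (B i).1 ⊆ C.1, ((μ (B i).1).toNNReal : ℝ≥0∞) * φ i (gridCount B ξ) := by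
    filter_upwards [ae_all_iff.2 fun i => hQ.ae_eq_natPart (B i)] with ξ hξ
    have hb := lintegral_biUnion_finset (μ := μ) (s := Finset.univ.filter fun i => (B i).1 ⊆ C.1)
      (t := fun i => (B i).1) (fun i _ j _ hij => hB.disjoint hij) (fun i _ => (B i).2.1) (Φ ξ)
    rw [hB.biUnion_eq hC] at hb
    rw [hb]
    refine Finset.sum_congr rfl fun i _ => ?_
    rw [setLIntegral_congr_fun (B i).2.1 (fun x hx => h ξ hξ i x hx), setLIntegral_const,
      mul_comm, ENNReal.coe_toNNReal (B i).2.2]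
  rw [lintegral_congr_ae e1, lintegral_finsetSum]
  · refine Finset.sum_congr rfl fun i _ => ?_
    rw [lintegral_map .of_discrete (measurable_gridCount B)]
    exact lintegral_const_mul _ (Measurable.of_discrete.comp (measurable_gridCount B))
  · intro i _
    exact (Measurable.of_discrete.comp (measurable_gridCount B)).const_mul _

end Law

/-! ### Cylinder functionals: uniqueness and approximation. -/

section Density

variable {X : Type*} [MeasurableSpace X] {μ : Measure X}

/-- The numbers of points in all the sets of finite measure. -/
def evalAll (μ : Measure X) (ξ : CountingMeasure X) (A : FiniteSet μ) : ℝ≥0∞ := ξ.1 A.1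

lemma measurable_evalAll : Measurable (evalAll μ) :=
  measurable_pi_lambda _ fun A => CountingMeasure.measurable_eval A.2.1

/-- The sets of finite measure suffice to generate the `σ`-field on the counting measures. -/
lemma le_comap_evalAll [SigmaFinite μ] :
    (inferInstance : MeasurableSpace (CountingMeasure X)) ≤
      MeasurableSpace.comap (evalAll μ) inferInstance := by
  have h : @Measurable _ _ (MeasurableSpace.comap (evalAll μ) inferInstance) inferInstance
      (id : CountingMeasure X → CountingMeasure X) := by
    refine CountingMeasure.measurable_of_measurable_eval
      (mE := MeasurableSpace.comap (evalAll μ) inferInstance) fun A hA => ?_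
    -- By `σ`-finiteness, `A` is a countable disjoint union of sets of finite measure, and its count
    -- is the sum of theirs.
    let D : ℕ → FiniteSet μ := fun n => ⟨A ∩ disjointed (spanningSets μ) n,
      hA.inter (MeasurableSet.disjointed (measurableSet_spanningSets μ) n),
      ne_top_of_le_ne_top (measure_spanningSets_lt_top μ n).ne
        (measure_mono (Set.inter_subset_right.trans (disjointed_subset _ _)))⟩
    have e : (fun ξ : CountingMeasure X => (id ξ).1 A) =
        (fun z : FiniteSet μ → ℝ≥0∞ => ∑' n, z (D n)) ∘ evalAll μ := by
      funext ξ
      have hu : A = ⋃ n, (D n).1 := by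
        simp only [D]
        rw [← Set.inter_iUnion, iUnion_disjointed, iUnion_spanningSets, Set.inter_univ]
      simp only [id, Function.comp, evalAll]
      conv_lhs => rw [hu]
      refine measure_iUnion (fun i j hij => ?_) fun n => (D n).2.1
      exact ((disjoint_disjointed (spanningSets μ)) hij).mono Set.inter_subset_right
        Set.inter_subset_right
    rw [e]
    refine Measurable.comp ?_ (comap_measurable _)
    exact Measurable.tsum fun n => measurable_pi_apply _
  intro S hS
  exact h hS

lemma exists_measurable_comp_evalAll [SigmaFinite μ] {G : CountingMeasure X → ℝ}
    (hG : Measurable G) :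
    ∃ G' : (FiniteSet μ → ℝ≥0∞) → ℝ, Measurable G' ∧ G = G' ∘ evalAll μ :=
  Measurable.exists_eq_measurable_comp (hG.mono (le_comap_evalAll (μ := μ)) le_rfl)

/-- Two finite measures on the counting measures agree if they agree on the cylinder sets. -/
lemma ext_of_evalOn [SigmaFinite μ] {Q₁ Q₂ : Measure (CountingMeasure X)} [IsFiniteMeasure Q₁]
    (h : ∀ (s : Finset (FiniteSet μ)) (S : Set (s → ℝ≥0∞)), MeasurableSet S →
      Q₁ (evalOn s ⁻¹' S) = Q₂ (evalOn s ⁻¹' S)) : Q₁ = Q₂ := by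
  have key : Q₁.map (evalAll μ) = Q₂.map (evalAll μ) := by
    refine ext_of_generate_finite _ generateFrom_measurableCylinders.symm
      isPiSystem_measurableCylinders ?_ ?_
    · intro T hT
      obtain ⟨s, S, hS, rfl⟩ := (mem_measurableCylinders _).1 hT
      rw [Measure.map_apply measurable_evalAll (hS.cylinder s),
        Measure.map_apply measurable_evalAll (hS.cylinder s)]
      exact h s S hS
    · rw [Measure.map_apply measurable_evalAll .univ, Measure.map_apply measurable_evalAll .univ]
      simpa using h ∅ Set.univ .univ
  ext S hS
  obtain ⟨T, hT, rfl⟩ := le_comap_evalAll (μ := μ) S hS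
  rw [← Measure.map_apply measurable_evalAll hT, key, Measure.map_apply measurable_evalAll hT]

/-- Functions of the numbers of points in finitely many sets of finite measure are dense. -/
lemma exists_cylinder_approx [SigmaFinite μ] (Q : Measure (CountingMeasure X)) [IsFiniteMeasure Q]
    {G : CountingMeasure X → ℝ} (hG : Measurable G) {c M : ℝ} (hm : ∀ ξ, G ξ ∈ Set.Icc c M)
    {ε : ℝ≥0∞} (hε : ε ≠ 0) :
    ∃ (s : Finset (FiniteSet μ)) (h : (s → ℝ≥0∞) → ℝ), Measurable h ∧
      (∀ z, h z ∈ Set.Icc c M) ∧ ∫⁻ ξ, ‖G ξ - h (evalOn s ξ)‖ₑ ∂Q ≤ ε := by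
  classical
  obtain ⟨G', hG', rfl⟩ := exists_measurable_comp_evalAll (μ := μ) hG
  -- The space of counting measures is never empty, since it contains the zero measure.
  have hcM : c ≤ M := by
    by_contra! hlt
    by_cases hne : Nonempty (CountingMeasure X)
    · exact absurd ((hm hne.some).1.trans (hm hne.some).2) (not_le.2 hlt)
    · refine hne ⟨⟨0, inferInstance, Empty, inferInstance, Empty.elim, ?_⟩⟩
      ext B hB
      simp
  let ρ := Q.map (evalAll μ)
  have hR : IsFiniteMeasure ρ := Measure.isFiniteMeasure_map Q _
  have hdense : ρ.MeasureDense (measurableCylinders fun _ : FiniteSet μ => ℝ≥0∞) :=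
    Measure.MeasureDense.of_generateFrom_isSetAlgebra_finite ρ isSetAlgebra_measurableCylinders
      generateFrom_measurableCylinders.symm
  -- Clipping to `[c, M]` is `1`-Lipschitz and fixes the values of `G`, so it keeps the approximants
  -- in range at no cost in `L¹`.
  let cl : ℝ → ℝ := fun t => max c (min M t)
  have hcl : Measurable cl := by fun_prop
  have hG1 : MemLp (fun z => cl (G' z)) 1 ρ := by
    refine memLp_one_iff_integrable.2 (Integrable.of_mem_Icc c M (hcl.comp hG').aemeasurable
      (ae_of_all _ fun z => ⟨le_max_left _ _, max_le hcM (min_le_left _ _)⟩))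
  let C : ((FiniteSet μ → ℝ≥0∞) → ℝ) → Prop := fun g =>
    ∃ (s : Finset (FiniteSet μ)) (h : (s → ℝ≥0∞) → ℝ), Measurable h ∧ g = h ∘ s.restrict
  have hrs : ∀ s : Finset (FiniteSet μ), Measurable
      (s.restrict : (FiniteSet μ → ℝ≥0∞) → (s → ℝ≥0∞)) := fun s =>
    Finset.measurable_restrict s
  have hd := MemLp.induction_dense (ENNReal.one_ne_top) C ?_ ?_ ?_ hG1 hε
  obtain ⟨g, hg, s, h, hh, rfl⟩ := hd
  · refine ⟨s, fun z => cl (h z), hcl.comp hh,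
      fun z => ⟨le_max_left _ _, max_le hcM (min_le_left _ _)⟩, ?_⟩
    refine le_trans ?_ hg
    rw [eLpNorm_one_eq_lintegral_enorm, lintegral_map ?_ measurable_evalAll]
    · refine lintegral_mono fun ξ => ?_
      have e : cl (G' (evalAll μ ξ)) = G' (evalAll μ ξ) := by
        have := hm ξ
        simp only [Function.comp] at this
        simp only [cl]
        rw [min_eq_right this.2, max_eq_right this.1]
      simp only [Function.comp, Pi.sub_apply]
      have hs : s.restrict (evalAll μ ξ) = evalOn s ξ := rfl
      rw [hs, Real.enorm_eq_ofReal_abs, Real.enorm_eq_ofReal_abs]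
      refine ENNReal.ofReal_le_ofReal ?_
      conv_rhs => rw [e]
      conv_lhs => rw [← e]
      simp only [cl]
      refine (abs_max_sub_max_le_max _ _ _ _).trans (max_le (by simp) ?_)
      exact (abs_min_sub_min_le_max _ _ _ _).trans (max_le (by simp) le_rfl)
    · exact ((hcl.comp hG').sub (hh.comp (hrs s))).enorm
  · intro a S hS _ δ hδ
    by_cases ha : a = 0
    · refine ⟨0, by simp [ha], ∅, 0, measurable_zero, rfl⟩
    obtain ⟨δ', hδ', hlt⟩ : ∃ δ' : ℝ, 0 < δ' ∧ ENNReal.ofReal δ' * ‖a‖ₑ ≤ δ := by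
      by_cases htop : δ = ∞
      · exact ⟨1, one_pos, by simp [htop]⟩
      · have ha' : 0 < ‖a‖ := norm_pos_iff.2 ha
        refine ⟨δ.toReal / ‖a‖, div_pos (ENNReal.toReal_pos hδ htop) ha', ?_⟩
        rw [← ofReal_norm, ← ENNReal.ofReal_mul (by positivity), div_mul_cancel₀ _ ha'.ne',
          ENNReal.ofReal_toReal htop]
    obtain ⟨T, hT, hTS⟩ := hdense.approx S hS (measure_ne_top _ _) δ' hδ'
    obtain ⟨s, U, hU, rfl⟩ := (mem_measurableCylinders _).1 hT
    refine ⟨(cylinder s U).indicator fun _ => a, ?_, s, U.indicator fun _ => a,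
      measurable_const.indicator hU, rfl⟩
    rw [eLpNorm_one_eq_lintegral_enorm]
    refine le_trans ?_ hlt
    calc _ ≤ ∫⁻ z, (symmDiff S (cylinder s U)).indicator (fun _ => ‖a‖ₑ) z ∂ρ := by
          refine lintegral_mono fun z => ?_
          by_cases h1 : z ∈ S <;> by_cases h2 : z ∈ cylinder s U <;>
            simp [h1, h2, Set.mem_symmDiff]
      _ = ‖a‖ₑ * ρ (symmDiff S (cylinder s U)) :=
          lintegral_indicator_const (hS.symmDiff (hU.cylinder s)) _
      _ ≤ _ := by
          rw [mul_comm]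
          gcongr
  · rintro - - ⟨s₁, h₁, hh₁, rfl⟩ ⟨s₂, h₂, hh₂, rfl⟩
    refine ⟨s₁ ∪ s₂, fun z => h₁ (fun A => z ⟨A.1, Finset.mem_union_left _ A.2⟩) +
      h₂ (fun A => z ⟨A.1, Finset.mem_union_right _ A.2⟩), ?_, rfl⟩
    refine (hh₁.comp ?_).add (hh₂.comp ?_) <;> fun_prop
  · rintro - ⟨s, h, hh, rfl⟩
    exact (hh.comp (hrs s)).aestronglyMeasurable

end Density

/-! ### The Mecke formula. -/

section Mecke

variable {X : Type*} [MeasurableSpace X] {μ : Measure X} {Q : Measure (CountingMeasure X)}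

lemma IsGrid.mono {s t : Finset (FiniteSet μ)} {n : ℕ} {B : Fin n → FiniteSet μ}
    (hB : IsGrid t B) (hst : s ⊆ t) : IsGrid s B :=
  ⟨hB.disjoint, fun A hA => hB.subset_iUnion A (hst hA)⟩

/-- The Mecke formula, for the points in a set of finite measure and functions of the process. -/
lemma IsPoissonProcess.map_add_eq_withDensity [SigmaFinite μ] [IsProbabilityMeasure Q]
    (hQ : IsPoissonProcess Q μ id) (C : FiniteSet μ) :
    (Q.prod (μ.restrict C.1)).map (fun z => z.1.add z.2) = Q.withDensity fun ξ => ξ.1 C.1 := by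
  classical
  have : IsFiniteMeasure (μ.restrict C.1) := isFiniteMeasure_restrict.2 C.2.2
  refine ext_of_evalOn (μ := μ) fun s S hS => ?_
  obtain ⟨n, B, hB⟩ := exists_isGrid (insert C s)
  have hBs : IsGrid s B := hB.mono (Finset.subset_insert _ _)
  have hC : C ∈ insert C s := Finset.mem_insert_self _ _
  have hES : MeasurableSet (evalOn s ⁻¹' S) := measurable_evalOn s hS
  have hmul : Measurable fun ξ : CountingMeasure X =>
      (evalOn s ⁻¹' S).indicator (1 : CountingMeasure X → ℝ≥0∞) ξ :=
    measurable_one.indicator hES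
  have e1 : (Q.prod (μ.restrict C.1)).map (fun z => z.1.add z.2) (evalOn s ⁻¹' S) =
      ∫⁻ ξ, ∫⁻ x in C.1, (evalOn s ⁻¹' S).indicator 1 (ξ.add x) ∂μ ∂Q := by
    rw [← lintegral_indicator_one hES, lintegral_map hmul CountingMeasure.measurable_add]
    exact lintegral_prod _ (hmul.comp CountingMeasure.measurable_add).aemeasurable
  -- On a cylinder set, both sides become sums over the cells inside `C`, and they agree term by
  -- term by the Mecke formula for a single Poisson coordinate.
  rw [e1, hQ.lintegral_grid hB hC
    (φ := fun i k => S.indicator 1 (gridEval s B (k + Pi.single i 1))) ?_]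
  · rw [withDensity_apply _ hES, ← lintegral_indicator hES]
    have e2 : ∀ᵐ ξ ∂Q, (evalOn s ⁻¹' S).indicator (fun ξ => ξ.1 C.1) ξ =
        (fun k : Fin n → ℕ => ∑ i with (B i).1 ⊆ C.1, (k i : ℝ≥0∞) *
          S.indicator 1 (gridEval s B k)) (gridCount B ξ) := by
      filter_upwards [ae_all_iff.2 fun i => hQ.ae_eq_natPart (B i)] with ξ hξ
      rw [← Finset.sum_mul, ← hBs.evalOn_eq hξ]
      have : ξ.1 C.1 = ∑ i with (B i).1 ⊆ C.1, (gridCount B ξ i : ℝ≥0∞) := by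
        rw [hB.measure_eq hC]
        exact Finset.sum_congr rfl fun i _ => hξ i
      rw [← this]
      by_cases h : evalOn s ξ ∈ S
      · rw [Set.indicator_of_mem (Set.mem_preimage.2 h), Set.indicator_of_mem h]
        simp
      · rw [Set.indicator_of_notMem (by exact h), Set.indicator_of_notMem h, mul_zero]
    rw [lintegral_congr_ae e2, ← lintegral_map (f := fun k : Fin n → ℕ =>
        ∑ i with (B i).1 ⊆ C.1, (k i : ℝ≥0∞) * S.indicator 1 (gridEval s B k))
        .of_discrete (measurable_gridCount B),
      hQ.map_gridCount hB, lintegral_finsetSum _ fun _ _ => .of_discrete]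
    refine Finset.sum_congr rfl fun i _ => ?_
    exact (lintegral_mul_piPoisson (fun i => (μ (B i).1).toNNReal) i
      fun k => S.indicator 1 (gridEval s B k)).symm
  · intro ξ hξ i x hx
    rw [← hBs.evalOn_add_eq hξ hx]
    rfl

/-- The identity on the counting measures is almost surely an `s`-finite kernel. -/
lemma IsPoissonProcess.exists_kernel [SigmaFinite μ] (hQ : IsPoissonProcess Q μ id) :
    ∃ κ : Kernel (CountingMeasure X) X, IsSFiniteKernel κ ∧ ∀ᵐ ξ ∂Q, κ ξ = ξ.1 := by
  let D : ℕ → FiniteSet μ := fun n => ⟨disjointed (spanningSets μ) n,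
    MeasurableSet.disjointed (measurableSet_spanningSets μ) n,
    ne_top_of_le_ne_top (measure_spanningSets_lt_top μ n).ne (measure_mono (disjointed_subset _ _))⟩
  have hset : ∀ m : ℕ × ℕ, MeasurableSet {ξ : CountingMeasure X | ξ.1 (D m.1).1 = m.2} := fun m =>
    (CountingMeasure.measurable_eval (D m.1).2.1) (measurableSet_singleton _)
  -- Restricting to the `n`-th piece on the event that it contains exactly `k` points gives a kernel
  -- of mass at most `k`. Almost surely each piece has a finite integer count, so exactly one `k`
  -- contributes for each `n`.
  let κ₀ : ℕ × ℕ → Kernel (CountingMeasure X) X := fun m =>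
    { toFun := fun ξ => {ξ : CountingMeasure X | ξ.1 (D m.1).1 = m.2}.indicator
        (fun ξ => ξ.1.restrict (D m.1).1) ξ
      measurable' := by
        refine Measurable.indicator (Measure.measurable_of_measurable_coe _ fun A hA => ?_) (hset m)
        simp_rw [Measure.restrict_apply hA]
        exact CountingMeasure.measurable_eval (hA.inter (D m.1).2.1) }
  have hκ₀ : ∀ m ξ, κ₀ m ξ = {ξ : CountingMeasure X | ξ.1 (D m.1).1 = m.2}.indicator
        (fun ξ => ξ.1.restrict (D m.1).1) ξ := fun _ _ => rfl
  have hfin : ∀ m, IsFiniteKernel (κ₀ m) := by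
    refine fun m => ⟨m.2, ENNReal.natCast_lt_top _, fun ξ => ?_⟩
    rw [hκ₀]
    by_cases h : ξ.1 (D m.1).1 = m.2
    · rw [Set.indicator_of_mem (by exact h), Measure.restrict_apply_univ, h]
    · rw [Set.indicator_of_notMem (by exact h)]
      simp
  refine ⟨Kernel.sum κ₀, inferInstance, ?_⟩
  filter_upwards [ae_all_iff.2 fun n => hQ.ae_eq_natPart (D n)] with ξ hξ
  have hu : ⋃ n, (D n).1 = Set.univ := by
    simp only [D]
    rw [iUnion_disjointed, iUnion_spanningSets]
  ext A hA
  rw [Kernel.sum_apply, Measure.sum_apply _ hA,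
    ENNReal.tsum_prod (f := fun n k => κ₀ (n, k) ξ A)]
  conv_rhs => rw [← Measure.restrict_univ (μ := ξ.1), ← hu, Measure.restrict_iUnion
    (fun i j hij => (disjoint_disjointed (spanningSets μ)) hij) fun n => (D n).2.1,
    Measure.sum_apply _ hA]
  refine tsum_congr fun n => ?_
  rw [tsum_eq_single (natPart (ξ.1 (D n).1))]
  · rw [hκ₀, Set.indicator_of_mem (by exact hξ n)]
  · intro k hk
    rw [hκ₀, Set.indicator_of_notMem]
    · simp
    · intro h
      refine hk ?_
      have h' : ξ.1 (D n).1 = k := h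
      rw [h', natPart_natCast]

/-- The Mecke formula. -/
lemma IsPoissonProcess.lintegral_lintegral_eq [SigmaFinite μ] [IsProbabilityMeasure Q]
    (hQ : IsPoissonProcess Q μ id) {h : CountingMeasure X × X → ℝ≥0∞} (hh : Measurable h) :
    AEMeasurable (fun ξ : CountingMeasure X => ∫⁻ x, h (ξ, x) ∂ξ.1) Q ∧
    ∫⁻ ξ, ∫⁻ x, h (ξ, x) ∂ξ.1 ∂Q = ∫⁻ ξ, ∫⁻ x, h (ξ.add x, x) ∂μ ∂Q := by
  obtain ⟨κ, hκs, hκ⟩ := hQ.exists_kernel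
  have hae : (fun ξ => ∫⁻ x, h (ξ, x) ∂κ ξ) =ᵐ[Q] fun ξ => ∫⁻ x, h (ξ, x) ∂ξ.1 := by
    filter_upwards [hκ] with ξ hξ
    rw [hξ]
  refine ⟨⟨_, hh.lintegral_kernel_prod_right', hae.symm⟩, ?_⟩
  rw [← lintegral_congr_ae hae]
  let D : ℕ → FiniteSet μ := fun n => ⟨disjointed (spanningSets μ) n,
    MeasurableSet.disjointed (measurableSet_spanningSets μ) n,
    ne_top_of_le_ne_top (measure_spanningSets_lt_top μ n).ne (measure_mono (disjointed_subset _ _))⟩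
  have hu : ⋃ n, (D n).1 = Set.univ := by
    simp only [D]
    rw [iUnion_disjointed, iUnion_spanningSets]
  have hdis : Pairwise fun i j => Disjoint (D i).1 (D j).1 :=
    fun i j hij => (disjoint_disjointed (spanningSets μ)) hij
  have mT : Measurable fun z : CountingMeasure X × X => (z.1.add z.2, z.2) :=
    CountingMeasure.measurable_add.prodMk measurable_snd
  have key : ∀ n, (Q.prod (μ.restrict (D n).1)).map (fun z => (z.1.add z.2, z.2)) =
      Q.compProd (κ.restrict (D n).2.1) := by
    intro n
    have : IsFiniteMeasure (μ.restrict (D n).1) := isFiniteMeasure_restrict.2 (D n).2.2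
    refine Measure.ext_prod fun {S T} hS hT => ?_
    -- For a rectangle `S ×ˢ T`, the restriction of the point to `T` is absorbed into the set of
    -- finite measure.
    let C : FiniteSet μ := ⟨T ∩ (D n).1, hT.inter (D n).2.1,
      ne_top_of_le_ne_top (D n).2.2 (measure_mono Set.inter_subset_right)⟩
    have hM := congrArg (fun m => m S) (hQ.map_add_eq_withDensity C)
    rw [Measure.compProd_apply_prod hS hT, Measure.map_apply mT (hS.prod hT)]
    rw [Measure.map_apply CountingMeasure.measurable_add hS, withDensity_apply _ hS] at hM
    have e : ∫⁻ ξ in S, (κ.restrict (D n).2.1) ξ T ∂Q = ∫⁻ ξ in S, ξ.1 C.1 ∂Q := by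
      refine lintegral_congr_ae (ae_restrict_of_ae ?_)
      filter_upwards [hκ] with ξ hξ
      rw [Kernel.restrict_apply, hξ, Measure.restrict_apply hT]
    rw [e, ← hM]
    have e2 : μ.restrict C.1 = (μ.restrict (D n).1).restrict T := by
      rw [Measure.restrict_restrict hT]
    have e3 : Q.prod (μ.restrict C.1) = (Q.prod (μ.restrict (D n).1)).restrict
        (Set.univ ×ˢ T) := by
      rw [e2, ← Measure.prod_restrict, Measure.restrict_univ]
    rw [e3, Measure.restrict_apply (CountingMeasure.measurable_add hS)]
    congr 1
    ext z
    simp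
  have e1 : ∀ (ν : Measure X) (u : X → ℝ≥0∞), ∫⁻ x, u x ∂ν = ∑' n, ∫⁻ x in (D n).1, u x ∂ν := by
    intro ν u
    rw [← lintegral_iUnion (fun n => (D n).2.1) hdis, hu, Measure.restrict_univ]
  rw [lintegral_congr fun ξ => e1 (κ ξ) _, lintegral_congr fun ξ => e1 μ _]
  rw [lintegral_tsum, lintegral_tsum]
  · refine tsum_congr fun n => ?_
    have k2 : ∫⁻ z, h z ∂_ = ∫⁻ z, h z ∂_ := congrArg (fun m => ∫⁻ z, h z ∂m) (key n)
    have k3 : ∫⁻ z, h (z.1.add z.2, z.2) ∂(Q.prod (μ.restrict (D n).1)) =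
        ∫⁻ ξ, ∫⁻ x in (D n).1, h (ξ.add x, x) ∂μ ∂Q := lintegral_prod _ (hh.comp mT).aemeasurable
    rw [lintegral_map hh mT, Measure.lintegral_compProd hh, k3] at k2
    simp only [Kernel.restrict_apply] at k2
    exact k2.symm
  · intro n
    exact ((hh.comp mT).lintegral_prod_right' (ν := μ.restrict (D n).1)).aemeasurable
  · intro n
    have := (hh.lintegral_kernel_prod_right' (κ := κ.restrict (D n).2.1))
    simp only [Kernel.restrict_apply] at this
    exact this.aemeasurable

end Mecke

/-! ### The entropy inequality for bounded functionals of the process. -/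

section Sobolev

variable {X : Type*} [MeasurableSpace X] {μ : Measure X} {Q : Measure (CountingMeasure X)}
  {r c M : ℝ}

lemma abs_powEnt_sub_le {E : Type*} [MeasurableSpace E] {ν : Measure E} [IsProbabilityMeasure ν]
    {L : ℝ} (hr : 1 < r) (hc : 0 < c)
    (hL : ∀ a ∈ Set.Icc c M, ∀ b ∈ Set.Icc c M, |a ^ r - b ^ r| ≤ L * |a - b|) (hL0 : 0 ≤ L)
    {g h : E → ℝ} (hg : Measurable g) (hh : Measurable h) (hgm : ∀ x, g x ∈ Set.Icc c M)
    (hhm : ∀ x, h x ∈ Set.Icc c M) :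
    |powEnt r ν g - powEnt r ν h| ≤ 2 * L * ∫ x, |g x - h x| ∂ν := by
  have ig : Integrable g ν := Integrable.of_mem_Icc c M hg.aemeasurable (ae_of_all _ hgm)
  have ih : Integrable h ν := Integrable.of_mem_Icc c M hh.aemeasurable (ae_of_all _ hhm)
  have igr := integrable_rpow_of_mem_Icc (ν := ν) hr hc hg hgm
  have ihr := integrable_rpow_of_mem_Icc (ν := ν) hr hc hh hhm
  have h1 : |∫ x, g x ^ r ∂ν - ∫ x, h x ^ r ∂ν| ≤ L * ∫ x, |g x - h x| ∂ν := by
    rw [← integral_sub igr ihr, ← integral_const_mul]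
    refine abs_integral_le_integral_abs.trans ?_
    exact integral_mono (igr.sub ihr).abs ((ig.sub ih).abs.const_mul L)
      fun x => hL _ (hgm x) _ (hhm x)
  have h2 : |(∫ x, g x ∂ν) ^ r - (∫ x, h x ∂ν) ^ r| ≤ L * ∫ x, |g x - h x| ∂ν := by
    refine (hL _ (integral_mem_Icc hg hgm) _ (integral_mem_Icc hh hhm)).trans ?_
    rw [← integral_sub ig ih]
    gcongr
    exact abs_integral_le_integral_abs
  have e : powEnt r ν g - powEnt r ν h = (∫ x, g x ^ r ∂ν - ∫ x, h x ^ r ∂ν) -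
      ((∫ x, g x ∂ν) ^ r - (∫ x, h x ∂ν) ^ r) := by
    simp only [powEnt]; ring
  rw [e]
  refine (abs_sub _ _).trans ?_
  linarith

/-- A grid generated by `C`, `s₀` and `s` reduces this to `powEnt_piPoisson_le_of_approx`, with the
cells inside `C` as the selected coordinates; `h₀` depends on these only. -/
lemma IsPoissonProcess.powEnt_cylinder_le [SigmaFinite μ] [IsProbabilityMeasure Q]
    (hQ : IsPoissonProcess Q μ id) {L : ℝ} (hr : 1 < r) (hr2 : r ≤ 2) (hc : 0 < c)
    (hL : ∀ a ∈ Set.Icc c M, ∀ b ∈ Set.Icc c M, |a ^ r - b ^ r| ≤ L * |a - b|) (hL0 : 0 ≤ L)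
    {s₀ s : Finset (FiniteSet μ)} {h₀ : (s₀ → ℝ≥0∞) → ℝ} {h : (s → ℝ≥0∞) → ℝ}
    (hm₀ : ∀ z, h₀ z ∈ Set.Icc c M) (hm : ∀ z, h z ∈ Set.Icc c M)
    (C : FiniteSet μ) (hC : ∀ A ∈ s₀, A.1 ⊆ C.1) :
    ENNReal.ofReal (powEnt r Q fun ξ => h (evalOn s ξ)) ≤
      ENNReal.ofReal (2 * L * ∫ ξ, |h (evalOn s ξ) - h₀ (evalOn s₀ ξ)| ∂Q) +
      ∫⁻ ξ, ∫⁻ x in C.1, ENNReal.ofReal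
        (powBregman r (h (evalOn s ξ)) (h (evalOn s (ξ.add x)))) ∂μ ∂Q := by
  classical
  obtain ⟨n, B, hB⟩ := exists_isGrid (insert C (s₀ ∪ s))
  have hBs : IsGrid s B := hB.mono (Finset.subset_union_right.trans (Finset.subset_insert _ _))
  have hBs₀ : IsGrid s₀ B := hB.mono (Finset.subset_union_left.trans (Finset.subset_insert _ _))
  set lam : Fin n → NNReal := fun i => (μ (B i).1).toNNReal
  set k : (Fin n → ℕ) → ℝ := fun z => h (gridEval s B z)
  set k₀ : (Fin n → ℕ) → ℝ := fun z => h₀ (gridEval s₀ B z)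
  have hae := ae_all_iff.2 fun i => hQ.ae_eq_natPart (B i)
  have e1 : ∀ᵐ ξ ∂Q, h (evalOn s ξ) = k (gridCount B ξ) := by
    filter_upwards [hae] with ξ hξ
    rw [hBs.evalOn_eq hξ]
  have e0 : ∀ᵐ ξ ∂Q, h₀ (evalOn s₀ ξ) = k₀ (gridCount B ξ) := by
    filter_upwards [hae] with ξ hξ
    rw [hBs₀.evalOn_eq hξ]
  have hmap := hQ.map_gridCount hB
  have hint : ∀ u : (Fin n → ℕ) → ℝ, ∫ ξ, u (gridCount B ξ) ∂Q = ∫ z, u z ∂(piPoisson lam) := by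
    intro u
    rw [← hmap, integral_map (measurable_gridCount B).aemeasurable
      Measurable.of_discrete.aestronglyMeasurable]
  have eE : powEnt r Q (fun ξ => h (evalOn s ξ)) = powEnt r (piPoisson lam) k := by
    simp only [powEnt]
    rw [← hint k, ← hint (fun z => k z ^ r), integral_congr_ae e1]
    congr 1
    refine integral_congr_ae ?_
    filter_upwards [e1] with ξ hξ
    rw [hξ]
  have eD : ∫ ξ, |h (evalOn s ξ) - h₀ (evalOn s₀ ξ)| ∂Q = ∫ z, |k z - k₀ z| ∂(piPoisson lam) := by
    rw [← hint fun z => |k z - k₀ z|]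
    refine integral_congr_ae ?_
    filter_upwards [e1, e0] with ξ hξ hξ'
    rw [hξ, hξ']
  have eJ := hQ.lintegral_grid hB (Finset.mem_insert_self C (s₀ ∪ s))
    (Φ := fun ξ x => ENNReal.ofReal (powBregman r (h (evalOn s ξ)) (h (evalOn s (ξ.add x)))))
    (φ := fun i z => ENNReal.ofReal (powBregman r (k z) (k (z + Pi.single i 1)))) (by
      intro ξ hξ i x hx
      simp only [k]
      rw [hBs.evalOn_eq hξ, hBs.evalOn_add_eq hξ hx])
  have main := powEnt_piPoisson_le_of_approx hr hr2 hc hL hL0 lam (fun i => (B i).1 ⊆ C.1)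
    (h := k) (h₀ := k₀) (fun _ => hm _) (fun _ => hm₀ _) (by
      intro z z' hz
      simp only [k₀]
      congr 1
      funext A
      refine Finset.sum_congr rfl fun i hi => ?_
      rw [hz i ((Finset.mem_filter.1 hi).2.trans (hC A.1 A.2))])
  have nn : ∀ i z, 0 ≤ powBregman r (k z) (k (z + Pi.single i 1)) := fun i z =>
    powBregman_nonneg hr (hc.trans_le (hm _).1).le (hc.trans_le (hm _).1).le
  rw [eE, eD, eJ]
  refine (ENNReal.ofReal_le_ofReal main).trans (ENNReal.ofReal_add_le.trans ?_)
  gcongr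
  have nni : ∀ i, 0 ≤ (lam i : ℝ) *
      ∫ z, powBregman r (k z) (k (z + Pi.single i 1)) ∂(piPoisson lam) := fun i =>
    mul_nonneg (lam i).coe_nonneg (integral_nonneg (nn i))
  rw [ENNReal.ofReal_sum_of_nonneg fun i _ => nni i]
  refine Finset.sum_le_sum fun i _ => ?_
  rw [ENNReal.ofReal_mul (lam i).coe_nonneg, ENNReal.ofReal_coe_nnreal, ofReal_integral_eq_lintegral_ofReal
    (integrable_powBregman hr hc .of_discrete .of_discrete (fun _ => hm _) fun _ => hm _)
    (ae_of_all _ (nn i))]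

lemma lintegral_lintegral_le_add {E : Type*} [MeasurableSpace E] {ν : Measure E} [SFinite μ]
    {a b : E × X → ℝ≥0∞} {e : E → ℝ≥0∞} {d : E → X → ℝ≥0∞} {K : ℝ≥0∞} (ha : Measurable a)
    (hb : Measurable b) (he : Measurable e) (h : ∀ z x, d z x ≤ a (z, x) + K * (e z + b (z, x)))
    (C : Set X) :
    ∫⁻ z, ∫⁻ x in C, d z x ∂μ ∂ν ≤ ∫⁻ z, ∫⁻ x, a (z, x) ∂μ ∂ν +
      K * (μ C * ∫⁻ z, e z ∂ν + ∫⁻ z, ∫⁻ x in C, b (z, x) ∂μ ∂ν) := by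
  have m1 : Measurable fun z => ∫⁻ x in C, a (z, x) ∂μ := ha.lintegral_prod_right'
  have m2 : Measurable fun z => ∫⁻ x in C, b (z, x) ∂μ := hb.lintegral_prod_right'
  have hd : ∀ z, ∫⁻ x in C, d z x ∂μ ≤ ∫⁻ x in C, a (z, x) ∂μ +
      K * (μ C * e z + ∫⁻ x in C, b (z, x) ∂μ) := by
    intro z
    have hz : Measurable fun x : X => (z, x) := measurable_prodMk_left
    have ha' : Measurable fun x => a (z, x) := ha.comp hz
    have hb' : Measurable fun x => b (z, x) := hb.comp hz
    have hc : Measurable fun x => e z + b (z, x) := measurable_const.add hb'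
    refine (lintegral_mono (h z)).trans (le_of_eq ?_)
    rw [lintegral_add_left ha', lintegral_const_mul _ hc,
      lintegral_add_left measurable_const, setLIntegral_const, mul_comm (μ C)]
  have m3 : Measurable fun z => μ C * e z + ∫⁻ x in C, b (z, x) ∂μ := (he.const_mul _).add m2
  refine (lintegral_mono hd).trans ?_
  rw [lintegral_add_left m1, lintegral_const_mul _ m3,
    lintegral_add_left (he.const_mul _), lintegral_const_mul _ he]
  exact add_le_add (lintegral_mono fun z => setLIntegral_le_lintegral _ _) le_rfl

/-- The Bregman divergences of the jumps depend continuously on the functional. -/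
lemma IsPoissonProcess.lintegral_powBregman_le [SigmaFinite μ] [IsProbabilityMeasure Q]
    (hQ : IsPoissonProcess Q μ id) {L : ℝ}
    (hLA : ∀ a ∈ Set.Icc c M, ∀ b ∈ Set.Icc c M, ∀ a' ∈ Set.Icc c M, ∀ b' ∈ Set.Icc c M,
      |powBregman r a b - powBregman r a' b'| ≤ L * (|a - a'| + |b - b'|)) (hL0 : 0 ≤ L)
    {G g : CountingMeasure X → ℝ} (hG : Measurable G) (mg : Measurable g)
    (hm : ∀ ξ, G ξ ∈ Set.Icc c M) (gm : ∀ ξ, g ξ ∈ Set.Icc c M) (C : FiniteSet μ) :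
    ∫⁻ ξ, ∫⁻ x in C.1, ENNReal.ofReal (powBregman r (g ξ) (g (ξ.add x))) ∂μ ∂Q ≤
      ∫⁻ ξ, ∫⁻ x, ENNReal.ofReal (powBregman r (G ξ) (G (ξ.add x))) ∂μ ∂Q +
        ENNReal.ofReal L * (μ C.1 * ∫⁻ ξ, ‖G ξ - g ξ‖ₑ ∂Q +
          ∫⁻ ξ, ‖G ξ - g ξ‖ₑ ∂(Q.withDensity fun ξ => ξ.1 C.1)) := by
  have hMecke := hQ.map_add_eq_withDensity C
  have mE : Measurable fun ξ => ‖G ξ - g ξ‖ₑ := (hG.sub mg).enorm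
  have mEadd : Measurable fun z : CountingMeasure X × X =>
      ‖G (z.1.add z.2) - g (z.1.add z.2)‖ₑ := mE.comp CountingMeasure.measurable_add
  have mA : Measurable fun z : CountingMeasure X × X =>
      ENNReal.ofReal (powBregman r (G z.1) (G (z.1.add z.2))) :=
    (measurable_powBregman (hG.comp measurable_fst)
      (hG.comp CountingMeasure.measurable_add)).ennreal_ofReal
  have pw : ∀ (ξ : CountingMeasure X) (x : X), ENNReal.ofReal (powBregman r (g ξ) (g (ξ.add x))) ≤
      ENNReal.ofReal (powBregman r (G ξ) (G (ξ.add x))) + ENNReal.ofReal L *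
        (‖G ξ - g ξ‖ₑ + ‖G (ξ.add x) - g (ξ.add x)‖ₑ) := by
    intro ξ x
    have hl := (abs_le.1 (hLA _ (gm ξ) _ (gm (ξ.add x)) _ (hm ξ) _ (hm (ξ.add x)))).2
    rw [abs_sub_comm (g ξ), abs_sub_comm (g (ξ.add x)), sub_le_iff_le_add'] at hl
    have h1 := (ENNReal.ofReal_le_ofReal hl).trans ENNReal.ofReal_add_le
    rw [ENNReal.ofReal_mul hL0, ENNReal.ofReal_add (abs_nonneg _) (abs_nonneg _)] at h1
    rwa [Real.enorm_eq_ofReal_abs, Real.enorm_eq_ofReal_abs]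
  -- By the Mecke formula, the error at `ξ + δ_x` is an `L¹` error with density `ξ(C)`, finite
  -- because `C` has finite measure.
  have eM : ∫⁻ ξ : CountingMeasure X, ∫⁻ x in C.1, ‖G (ξ.add x) - g (ξ.add x)‖ₑ ∂μ ∂Q =
      ∫⁻ ξ, ‖G ξ - g ξ‖ₑ ∂(Q.withDensity fun ξ => ξ.1 C.1) := by
    rw [← hMecke, lintegral_map mE CountingMeasure.measurable_add,
      lintegral_prod _ mEadd.aemeasurable]
  rw [← eM]
  exact lintegral_lintegral_le_add mA mEadd mE pw C.1

/-- The `φ`-entropy inequality for functionals of a Poisson process, for `φ(x) = x ^ r`. -/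
lemma IsPoissonProcess.powEnt_le [SigmaFinite μ] [IsProbabilityMeasure Q]
    (hQ : IsPoissonProcess Q μ id) (hr : 1 < r) (hr2 : r ≤ 2) (hc : 0 < c)
    {G : CountingMeasure X → ℝ} (hG : Measurable G) (hm : ∀ ξ, G ξ ∈ Set.Icc c M) :
    ENNReal.ofReal (powEnt r Q G) ≤
      ∫⁻ ξ, ∫⁻ x, ENNReal.ofReal (powBregman r (G ξ) (G (ξ.add x))) ∂μ ∂Q := by
  classical
  obtain ⟨L, hL0, hL, hLA⟩ := exists_powBregman_lipschitz (M := M) hr hc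
  refine ENNReal.le_of_forall_pos_le_add fun δ hδ _ => ?_
  -- The errors below add up to `7 * L * ε`; the `1` guards against `L = 0`.
  set ε : ℝ := δ / (8 * L + 1) with hε
  have hε0 : 0 < ε := by positivity
  have hεδ : 8 * L * ε ≤ δ := by
    rw [hε, mul_div_assoc', div_le_iff₀ (by positivity)]
    have : (0 : ℝ) ≤ δ := δ.2
    nlinarith
  have hε' : ENNReal.ofReal ε ≠ 0 := by simpa using hε0
  -- Two approximations avoid a circularity: jump errors can be controlled only over a set of finite
  -- measure, and that set must be known before approximating. The first approximation fixes `C`;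
  -- the second is also close under the measures that control the jumps in `C`, and its dependence
  -- on points outside `C` costs only its `L¹` distance to the first.
  obtain ⟨s₀, h₀, hh₀, hm₀, ha₀⟩ := exists_cylinder_approx (μ := μ) Q hG hm hε'
  let C : FiniteSet μ := ⟨⋃ A ∈ s₀, A.1, Finset.measurableSet_biUnion _ fun A _ => A.2.1,
    ((measure_biUnion_finset_le s₀ fun A => A.1).trans_lt
      (ENNReal.sum_lt_top.2 fun A _ => A.2.2.lt_top)).ne⟩
  have hC : ∀ A ∈ s₀, A.1 ⊆ C.1 := fun A hA => Set.subset_biUnion_of_mem (u := fun A => A.1) hA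
  have hMecke := hQ.map_add_eq_withDensity C
  have hfinC : IsFiniteMeasure (μ.restrict C.1) := isFiniteMeasure_restrict.2 C.2.2
  have hfin : IsFiniteMeasure (Q.withDensity fun ξ => ξ.1 C.1) := by
    rw [← hMecke]; infer_instance
  have hfin2 : IsFiniteMeasure ((μ C.1) • Q) := ⟨by
    simpa using C.2.2.lt_top⟩
  obtain ⟨s, h, hh, hmh, ha⟩ := exists_cylinder_approx (μ := μ)
    (Q + ((μ C.1) • Q + Q.withDensity fun ξ => ξ.1 C.1)) hG hm hε'
  set g : CountingMeasure X → ℝ := fun ξ => h (evalOn s ξ) with hg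
  set g₀ : CountingMeasure X → ℝ := fun ξ => h₀ (evalOn s₀ ξ) with hg₀
  have mg : Measurable g := hh.comp (measurable_evalOn s)
  have mg₀ : Measurable g₀ := hh₀.comp (measurable_evalOn s₀)
  have gm : ∀ ξ, g ξ ∈ Set.Icc c M := fun _ => hmh _
  have gm₀ : ∀ ξ, g₀ ξ ∈ Set.Icc c M := fun _ => hm₀ _
  rw [lintegral_add_measure, lintegral_add_measure] at ha
  have conv : ∀ u v : CountingMeasure X → ℝ, Measurable u → Measurable v →
      ∫⁻ ξ, ‖u ξ - v ξ‖ₑ ∂Q ≤ ENNReal.ofReal ε → ∫ ξ, |u ξ - v ξ| ∂Q ≤ ε := by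
    intro u v hu hv huv
    have : ∫ ξ, |u ξ - v ξ| ∂Q = (∫⁻ ξ, ‖u ξ - v ξ‖ₑ ∂Q).toReal :=
      integral_norm_eq_lintegral_enorm (hu.sub hv).aestronglyMeasurable
    rw [this]
    exact ENNReal.toReal_le_of_le_ofReal hε0.le huv
  have d1 : ∫ ξ, |G ξ - g ξ| ∂Q ≤ ε := conv G g hG mg (le_self_add.trans ha)
  have d0 : ∫ ξ, |G ξ - g₀ ξ| ∂Q ≤ ε := conv G g₀ hG mg₀ ha₀
  have iI : ∀ u : CountingMeasure X → ℝ, Measurable u → (∀ ξ, u ξ ∈ Set.Icc c M) →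
      Integrable u Q := fun u hu hum => Integrable.of_mem_Icc c M hu.aemeasurable (ae_of_all _ hum)
  have iG := iI G hG hm
  have ig := iI g mg gm
  have ig₀ := iI g₀ mg₀ gm₀
  have d2 : ∫ ξ, |g ξ - g₀ ξ| ∂Q ≤ 2 * ε := by
    calc _ ≤ ∫ ξ, (|G ξ - g ξ| + |G ξ - g₀ ξ|) ∂Q := by
          refine integral_mono (ig.sub ig₀).abs ((iG.sub ig).abs.add (iG.sub ig₀).abs) fun ξ => ?_
          have := abs_sub_le (g ξ) (G ξ) (g₀ ξ)
          rwa [abs_sub_comm (g ξ) (G ξ)] at this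
      _ = _ := integral_add (iG.sub ig).abs (iG.sub ig₀).abs
      _ ≤ _ := by linarith
  have b1 : powEnt r Q G ≤ powEnt r Q g + 2 * L * ε := by
    have := (le_abs_self _).trans (abs_powEnt_sub_le (ν := Q) hr hc hL hL0 hG mg hm gm)
    have : 2 * L * ∫ ξ, |G ξ - g ξ| ∂Q ≤ 2 * L * ε := by gcongr
    linarith
  have b2 := hQ.powEnt_cylinder_le hr hr2 hc hL hL0 hm₀ hmh C hC
  have b3 : ∫⁻ ξ, ∫⁻ x in C.1, ENNReal.ofReal (powBregman r (g ξ) (g (ξ.add x))) ∂μ ∂Q ≤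
      ∫⁻ ξ, ∫⁻ x, ENNReal.ofReal (powBregman r (G ξ) (G (ξ.add x))) ∂μ ∂Q +
        ENNReal.ofReal L * ENNReal.ofReal ε := by
    refine (hQ.lintegral_powBregman_le hLA hL0 hG mg hm gm C).trans ?_
    gcongr
    rw [lintegral_smul_measure] at ha
    exact le_add_self.trans ha
  calc ENNReal.ofReal (powEnt r Q G) ≤ ENNReal.ofReal (powEnt r Q g) + ENNReal.ofReal (2 * L * ε) :=
        (ENNReal.ofReal_le_ofReal b1).trans ENNReal.ofReal_add_le
    _ ≤ (ENNReal.ofReal (2 * L * (2 * ε)) +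
          (∫⁻ ξ, ∫⁻ x, ENNReal.ofReal (powBregman r (G ξ) (G (ξ.add x))) ∂μ ∂Q +
            ENNReal.ofReal L * ENNReal.ofReal ε)) + ENNReal.ofReal (2 * L * ε) := by
        refine add_le_add (b2.trans (add_le_add (ENNReal.ofReal_le_ofReal ?_) b3)) le_rfl
        gcongr
    _ = ∫⁻ ξ, ∫⁻ x, ENNReal.ofReal (powBregman r (G ξ) (G (ξ.add x))) ∂μ ∂Q +
          ENNReal.ofReal (2 * L * (2 * ε) + L * ε + 2 * L * ε) := by
        rw [ENNReal.ofReal_add (by positivity) (by positivity),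
          ENNReal.ofReal_add (by positivity) (by positivity), ENNReal.ofReal_mul hL0]
        ring
    _ ≤ _ := by
        gcongr
        rw [← ENNReal.ofReal_coe_nnreal]
        refine ENNReal.ofReal_le_ofReal ?_
        have : 0 ≤ L * ε := by positivity
        linarith

end Sobolev

/-! ### From Bregman divergences of jumps to `V⁺`, and removal of the truncations. -/

section VPlus

variable {X : Type*} [MeasurableSpace X] {μ : Measure X} {Q : Measure (CountingMeasure X)}
  {f : CountingMeasure X → ℝ} {k : CountingMeasure X × X → ℝ}

/-- A measurable version of `f (ξ - δ_x)`. -/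
lemma exists_measurable_sub (hf : Measurable f) :
    ∃ k : CountingMeasure X × X → ℝ, Measurable k ∧ ∀ ζ x, k (ζ.add x, x) = f ζ := by
  let D : Set (CountingMeasure X × X) := {z | ∃ ζ : CountingMeasure X, ζ.add z.2 = z.1}
  let T : D → CountingMeasure X := fun z => z.1.1.sub z.1.2
  have hT : Measurable T := by
    refine CountingMeasure.measurable_of_measurable_eval fun B hB => ?_
    have e : (fun z : D => (T z).1 B) = fun z : D => z.1.1.1 B - B.indicator 1 z.1.2 := by
      funext z
      obtain ⟨⟨ξ, x⟩, ζ, hζ⟩ := z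
      have h : ζ.add x = ξ := hζ
      subst h
      change ((ζ.add x).sub x).1 B = (ζ.add x).1 B - B.indicator 1 x
      rw [CountingMeasure.sub_add, CountingMeasure.add_apply _ _ hB, ENNReal.add_sub_cancel_right]
      exact ne_top_of_le_ne_top ENNReal.one_ne_top (Set.indicator_le_self' (by simp) x)
    rw [e]
    exact ((CountingMeasure.measurable_eval hB).comp (measurable_fst.comp measurable_subtype_coe)).sub
      ((measurable_one.indicator hB).comp (measurable_snd.comp measurable_subtype_coe))
  -- `D` need not be measurable, but a function measurable for its trace `σ`-field is the
  -- restriction of a measurable function on the whole space.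
  obtain ⟨k, hk, hkT⟩ := Measurable.exists_eq_measurable_comp (f := (Subtype.val : D → _))
    (g := fun z => f (T z)) (hf.comp hT)
  refine ⟨k, hk, fun ζ x => ?_⟩
  have h := congrFun hkT ⟨(ζ.add x, x), ζ, rfl⟩
  have h' : f ((ζ.add x).sub x) = k (ζ.add x, x) := h
  rw [← h', CountingMeasure.sub_add]

/-- At the points of `ξ` the removal is genuine, so there `k (ξ, x)` equals `f (ξ - δ_x)`. The sum
over points becomes a Lebesgue integral, to which the Mecke formula applies. -/
lemma vPlus_eq (hk : Measurable k) (hkf : ∀ ζ x, k (ζ.add x, x) = f ζ)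
    (ξ : CountingMeasure X) :
    vPlus μ f ξ = ∫⁻ x, ENNReal.ofReal (min 0 (diffOp f x ξ) ^ 2) ∂μ +
      ∫⁻ x, ENNReal.ofReal (max 0 (f ξ - k (ξ, x)) ^ 2) ∂ξ.1 := by
  have hξ : Measurable fun x : X => (ξ, x) := measurable_prodMk_left
  have hk' : Measurable fun x => k (ξ, x) := hk.comp hξ
  rw [vPlus, ← CountingMeasure.integral_eq_lintegral _ (by fun_prop)]
  congr 1
  refine tsum_congr fun i => ?_
  have h := hkf (ξ.sub (ξ.point i)) (ξ.point i)
  rw [CountingMeasure.sub_point_add] at h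
  simp only [h]

lemma measurable_diffOp (hf : Measurable f) :
    Measurable fun z : CountingMeasure X × X => diffOp f z.2 z.1 :=
  (hf.comp CountingMeasure.measurable_add).sub (hf.comp measurable_fst)

lemma IsPoissonProcess.lintegral_mul_add [SigmaFinite μ] [IsProbabilityMeasure Q]
    (hQ : IsPoissonProcess Q μ id) {a b : CountingMeasure X × X → ℝ≥0∞} (ha : Measurable a)
    (hb : Measurable b) {w : CountingMeasure X → ℝ≥0∞} (hw : Measurable w) :
    AEMeasurable (fun ξ : CountingMeasure X => ∫⁻ x, a (ξ, x) ∂μ + ∫⁻ x, b (ξ, x) ∂ξ.1) Q ∧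
    ∫⁻ ξ, w ξ * (∫⁻ x, a (ξ, x) ∂μ + ∫⁻ x, b (ξ, x) ∂ξ.1) ∂Q =
      ∫⁻ ξ, ∫⁻ x, (w ξ * a (ξ, x) + w (ξ.add x) * b (ξ.add x, x)) ∂μ ∂Q := by
  have m1 : Measurable fun ξ => ∫⁻ x, a (ξ, x) ∂μ := ha.lintegral_prod_right'
  obtain ⟨m2, -⟩ := hQ.lintegral_lintegral_eq hb
  have hwb : Measurable fun z : CountingMeasure X × X => w z.1 * b z :=
    (hw.comp measurable_fst).mul hb
  obtain ⟨-, e⟩ := hQ.lintegral_lintegral_eq hwb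
  refine ⟨m1.aemeasurable.add m2, ?_⟩
  have s1 : ∀ ξ : CountingMeasure X, Measurable fun x : X => (ξ, x) :=
    fun ξ => measurable_prodMk_left
  have sa : ∀ ξ, Measurable fun x => a (ξ, x) := fun ξ => ha.comp (s1 ξ)
  have sb : ∀ ξ, Measurable fun x => b (ξ, x) := fun ξ => hb.comp (s1 ξ)
  have l1 : ∀ ξ : CountingMeasure X, w ξ * (∫⁻ x, a (ξ, x) ∂μ + ∫⁻ x, b (ξ, x) ∂ξ.1) =
      w ξ * ∫⁻ x, a (ξ, x) ∂μ + ∫⁻ x, w ξ * b (ξ, x) ∂ξ.1 := by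
    intro ξ
    rw [mul_add, lintegral_const_mul _ (sb ξ)]
  have l2 : ∀ ξ : CountingMeasure X,
      ∫⁻ x, (w ξ * a (ξ, x) + w (ξ.add x) * b (ξ.add x, x)) ∂μ =
        w ξ * ∫⁻ x, a (ξ, x) ∂μ + ∫⁻ x, w (ξ.add x) * b (ξ.add x, x) ∂μ := by
    intro ξ
    have h : Measurable fun x => w ξ * a (ξ, x) := (sa ξ).const_mul _
    rw [lintegral_add_left h, lintegral_const_mul _ (sa ξ)]
  have m3 : Measurable fun ξ => w ξ * ∫⁻ x, a (ξ, x) ∂μ := hw.mul m1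
  rw [lintegral_congr l1, lintegral_congr l2, lintegral_add_left m3, lintegral_add_left m3, e]

/-- The Mecke formula for weighted integrals of `V⁺`. -/
lemma IsPoissonProcess.lintegral_mul_vPlus [SigmaFinite μ] [IsProbabilityMeasure Q]
    (hQ : IsPoissonProcess Q μ id) (hf : Measurable f) {w : CountingMeasure X → ℝ≥0∞}
    (hw : Measurable w) :
    AEMeasurable (vPlus μ f) Q ∧ ∫⁻ ξ, w ξ * vPlus μ f ξ ∂Q =
      ∫⁻ ξ, ∫⁻ x, (w ξ * ENNReal.ofReal (min 0 (diffOp f x ξ) ^ 2) +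
        w (ξ.add x) * ENNReal.ofReal (max 0 (diffOp f x ξ) ^ 2)) ∂μ ∂Q := by
  obtain ⟨k, hk, hkf⟩ := exists_measurable_sub hf
  have hf1 : Measurable fun z : CountingMeasure X × X => f z.1 := hf.comp measurable_fst
  have m1 : Measurable fun z : CountingMeasure X × X =>
      ENNReal.ofReal (min 0 (diffOp f z.2 z.1) ^ 2) :=
    ((measurable_const.min (measurable_diffOp hf)).pow_const 2).ennreal_ofReal
  have m2 : Measurable fun z : CountingMeasure X × X =>
      ENNReal.ofReal (max 0 (f z.1 - k z) ^ 2) :=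
    ((measurable_const.max (hf1.sub hk)).pow_const 2).ennreal_ofReal
  rw [funext (vPlus_eq hk hkf)]
  obtain ⟨h1, h2⟩ := hQ.lintegral_mul_add m1 m2 hw
  refine ⟨h1, h2.trans ?_⟩
  simp only [hkf]
  rfl

/-- Only a strict decrease of the truncated value matters. Then the larger value exceeds `c`, hence
is at most `a - m`, and the truncation shrinks the increment. -/
lemma clamp_rpow_mul_sq_le {a b c m n s : ℝ} (hc : 0 < c) (hs : 0 ≤ s) :
    max c (min (max 0 (a - m)) n) ^ s *
        max (max c (min (max 0 (a - m)) n) - max c (min (max 0 (b - m)) n)) 0 ^ 2 ≤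
      max 0 (a - m) ^ s * min 0 (b - a) ^ 2 := by
  set α := max c (min (max 0 (a - m)) n) with hα
  set β := max c (min (max 0 (b - m)) n) with hβ
  rcases le_or_gt α β with h | h
  · rw [max_eq_right (by linarith)]
    have := Real.rpow_nonneg (le_max_left 0 (a - m)) s
    rw [zero_pow two_ne_zero, mul_zero]
    positivity
  · have hcα : c < α := (le_max_left _ _).trans_lt h
    have h1 : c < min (max 0 (a - m)) n := by
      rcases lt_max_iff.1 hcα with h | h
      · exact absurd h (lt_irrefl _)
      · exact h
    have h2 : α = min (max 0 (a - m)) n := max_eq_right h1.le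
    have h3 : α ≤ max 0 (a - m) := h2.trans_le (min_le_left _ _)
    have h4 : min (max 0 (b - m)) n ≤ β := le_max_right _ _
    have h5 : max 0 (a - m) = a - m := by
      refine max_eq_right (le_of_not_gt fun h6 => ?_)
      rw [max_eq_left h6.le] at h3
      linarith
    have h6 : α ≤ n := h2.trans_le (min_le_right _ _)
    have h7 : α - β ≤ a - b := by
      rcases le_total (max 0 (b - m)) n with h8 | h8
      · rw [min_eq_left h8] at h4
        have := le_max_right 0 (b - m)
        linarith
      · rw [min_eq_right h8] at h4
        linarith
    rw [max_eq_left (by linarith), min_eq_right (by linarith)]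
    have h8 : (α - β) ^ 2 ≤ (b - a) ^ 2 := by
      rw [← neg_sq (b - a)]
      exact pow_le_pow_left₀ (by linarith) (by linarith) 2
    exact mul_le_mul (Real.rpow_le_rpow (by linarith) h3 hs) h8 (sq_nonneg _)
      (Real.rpow_nonneg (by linarith) _)

/-- The moments of the truncations of `(f - m)₊`. -/
lemma IsPoissonProcess.lintegral_clamp_rpow_le [SigmaFinite μ] [IsProbabilityMeasure Q]
    (hQ : IsPoissonProcess Q μ id) (hf : Measurable f) {p c n : ℝ} (m : ℝ) (hp : 2 ≤ p)
    (hc : 0 < c) (hcn : c ≤ n) :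
    ∫⁻ ξ, ENNReal.ofReal (max c (min (max 0 (f ξ - m)) n)) ^ p ∂Q ≤
      (∫⁻ ξ, ENNReal.ofReal (max c (min (max 0 (f ξ - m)) n)) ^ (p - 1) ∂Q) ^ (p / (p - 1)) +
        ENNReal.ofReal (p - 1) *
          ∫⁻ ξ, ENNReal.ofReal (max 0 (f ξ - m)) ^ (p - 2) * vPlus μ f ξ ∂Q := by
  have hp1 : 0 < p - 1 := by linarith
  have hr : 1 < p / (p - 1) := by rw [lt_div_iff₀ hp1]; linarith
  have hr2 : p / (p - 1) ≤ 2 := by rw [div_le_iff₀ hp1]; linarith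
  set U : CountingMeasure X → ℝ := fun ξ => max c (min (max 0 (f ξ - m)) n) with hU
  have mU : Measurable U := by fun_prop
  have hU0 : ∀ ξ, 0 < U ξ := fun ξ => hc.trans_le (le_max_left _ _)
  have hUn : ∀ ξ, U ξ ≤ n := fun ξ => max_le hcn (min_le_right _ _)
  have mG : Measurable fun ξ => U ξ ^ (p - 1) := by fun_prop
  have hG : ∀ ξ, U ξ ^ (p - 1) ∈ Set.Icc (c ^ (p - 1)) (n ^ (p - 1)) := fun ξ =>
    ⟨Real.rpow_le_rpow hc.le (le_max_left _ _) hp1.le,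
      Real.rpow_le_rpow (hU0 ξ).le (hUn ξ) hp1.le⟩
  -- The lower truncation by `c` and the upper one by `n` keep `U ^ (p - 1)` in a compact
  -- subinterval of the positive half-line.
  have key := hQ.powEnt_le hr hr2 (Real.rpow_pos_of_pos hc (p - 1)) mG hG
  have hw : Measurable fun ξ => ENNReal.ofReal (max 0 (f ξ - m)) ^ (p - 2) := by fun_prop
  have hs : 0 ≤ p - 2 := by linarith
  have bound : ∫⁻ ξ, ∫⁻ x, ENNReal.ofReal
        (powBregman (p / (p - 1)) (U ξ ^ (p - 1)) (U (ξ.add x) ^ (p - 1))) ∂μ ∂Q ≤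
      ENNReal.ofReal (p - 1) *
          ∫⁻ ξ, ENNReal.ofReal (max 0 (f ξ - m)) ^ (p - 2) * vPlus μ f ξ ∂Q := by
    rw [(hQ.lintegral_mul_vPlus hf hw).2, ← lintegral_const_mul' _ _ ENNReal.ofReal_ne_top]
    refine lintegral_mono fun ξ => ?_
    simp only
    rw [← lintegral_const_mul' _ _ ENNReal.ofReal_ne_top]
    refine lintegral_mono fun x => ?_
    have hx0 : ∀ ζ : CountingMeasure X, 0 ≤ max 0 (f ζ - m) := fun ζ => le_max_left _ _
    have hx1 : ∀ ζ : CountingMeasure X, 0 ≤ max 0 (f ζ - m) ^ (p - 2) :=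
      fun ζ => Real.rpow_nonneg (hx0 ζ) _
    simp only [ENNReal.ofReal_rpow_of_nonneg (hx0 _) hs]
    rw [← ENNReal.ofReal_mul (hx1 _), ← ENNReal.ofReal_mul (hx1 _), ← ENNReal.ofReal_add
      (mul_nonneg (hx1 _) (sq_nonneg _)) (mul_nonneg (hx1 _) (sq_nonneg _)),
      ← ENNReal.ofReal_mul hp1.le]
    refine ENNReal.ofReal_le_ofReal ((powBregman_rpow_le hp (hU0 _) (hU0 _)).trans ?_)
    refine mul_le_mul_of_nonneg_left (add_le_add ?_ ?_) hp1.le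
    · exact clamp_rpow_mul_sq_le hc hs
    · refine (clamp_rpow_mul_sq_le hc hs).trans (le_of_eq ?_)
      have : min 0 (f ξ - f (ξ.add x)) = - max 0 (f (ξ.add x) - f ξ) := by
        rw [← neg_sub, ← min_neg_neg, neg_zero]
      rw [this, neg_sq, diffOp]
  have e1 : ∀ ξ, (U ξ ^ (p - 1)) ^ (p / (p - 1)) = U ξ ^ p := by
    intro ξ
    rw [← Real.rpow_mul (hU0 ξ).le]; congr 1; field_simp
  have i1 := integrable_rpow_of_mem_Icc (ν := Q) hr (Real.rpow_pos_of_pos hc (p - 1)) mG hG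
  have i2 : Integrable (fun ξ => U ξ ^ (p - 1)) Q :=
    Integrable.of_mem_Icc _ _ mG.aemeasurable (ae_of_all _ hG)
  have e2 : ∫⁻ ξ, ENNReal.ofReal (U ξ) ^ p ∂Q =
      ENNReal.ofReal (∫ ξ, (U ξ ^ (p - 1)) ^ (p / (p - 1)) ∂Q) := by
    rw [ofReal_integral_eq_lintegral_ofReal i1 (ae_of_all _ fun ξ =>
      Real.rpow_nonneg (Real.rpow_nonneg (hU0 ξ).le _) _)]
    refine lintegral_congr fun ξ => ?_
    rw [e1, ENNReal.ofReal_rpow_of_pos (hU0 ξ)]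
  have e3 : ∫⁻ ξ, ENNReal.ofReal (U ξ) ^ (p - 1) ∂Q =
      ENNReal.ofReal (∫ ξ, U ξ ^ (p - 1) ∂Q) := by
    rw [ofReal_integral_eq_lintegral_ofReal i2 (ae_of_all _ fun ξ => Real.rpow_nonneg (hU0 ξ).le _)]
    refine lintegral_congr fun ξ => ?_
    rw [ENNReal.ofReal_rpow_of_pos (hU0 ξ)]
  have i0 : 0 ≤ ∫ ξ, U ξ ^ (p - 1) ∂Q := integral_nonneg fun ξ => Real.rpow_nonneg (hU0 ξ).le _
  change ∫⁻ ξ, ENNReal.ofReal (U ξ) ^ p ∂Q ≤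
    (∫⁻ ξ, ENNReal.ofReal (U ξ) ^ (p - 1) ∂Q) ^ (p / (p - 1)) + _
  rw [e2, e3, ENNReal.ofReal_rpow_of_nonneg i0 (by linarith)]
  refine le_trans ?_ (add_le_add le_rfl (key.trans bound))
  refine le_trans (ENNReal.ofReal_le_ofReal ?_) ENNReal.ofReal_add_le
  rw [powEnt]
  linarith

/-- Removal of the truncations. -/
lemma lintegral_rpow_le_of_clamp {E : Type*} [MeasurableSpace E] {ν : Measure E}
    [IsProbabilityMeasure ν] {u : E → ℝ} (hu : Measurable u) (hu0 : ∀ x, 0 ≤ u x) {p : ℝ}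
    (hp : 2 ≤ p) {K : ℝ≥0∞}
    (h : ∀ c n : ℝ, 0 < c → c ≤ n → ∫⁻ x, ENNReal.ofReal (max c (min (u x) n)) ^ p ∂ν ≤
      (∫⁻ x, ENNReal.ofReal (max c (min (u x) n)) ^ (p - 1) ∂ν) ^ (p / (p - 1)) + K) :
    ∫⁻ x, ENNReal.ofReal (u x) ^ p ∂ν ≤
      ((∫⁻ x, ENNReal.ofReal (u x) ^ (p - 1) ∂ν) ^ (1 / (p - 1))) ^ p + K := by
  have hp0 : 0 < p := by linarith
  have hp1 : 0 < p - 1 := by linarith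
  set A := (∫⁻ x, ENNReal.ofReal (u x) ^ (p - 1) ∂ν) ^ (1 / (p - 1)) with hA
  have mu : Measurable fun x => ENNReal.ofReal (u x) := hu.ennreal_ofReal
  have step1 : ∀ c n : ℝ, 0 < c → c ≤ n →
      ∫⁻ x, ENNReal.ofReal (min (u x) n) ^ p ∂ν ≤ (A + ENNReal.ofReal c) ^ p + K := by
    intro c n hc hcn
    calc ∫⁻ x, ENNReal.ofReal (min (u x) n) ^ p ∂ν
        ≤ ∫⁻ x, ENNReal.ofReal (max c (min (u x) n)) ^ p ∂ν := by
          refine lintegral_mono fun x => ENNReal.rpow_le_rpow ?_ hp0.le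
          exact ENNReal.ofReal_le_ofReal (le_max_right _ _)
      _ ≤ _ := h c n hc hcn
      _ ≤ (∫⁻ x, (ENNReal.ofReal (u x) + ENNReal.ofReal c) ^ (p - 1) ∂ν) ^ (p / (p - 1)) + K := by
          refine add_le_add (ENNReal.rpow_le_rpow (lintegral_mono fun x =>
            ENNReal.rpow_le_rpow ?_ hp1.le) (by positivity)) le_rfl
          rw [← ENNReal.ofReal_add (hu0 x) hc.le]
          refine ENNReal.ofReal_le_ofReal (max_le (by linarith [hu0 x]) ?_)
          exact (min_le_left _ _).trans (by linarith)
      _ ≤ (A + ENNReal.ofReal c) ^ p + K := by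
          have e : p / (p - 1) = 1 / (p - 1) * p := by ring
          rw [e, ENNReal.rpow_mul]
          refine add_le_add (ENNReal.rpow_le_rpow ?_ hp0.le) le_rfl
          -- Minkowski's inequality in `L^(p-1)`, applicable as `p - 1 ≥ 1`; it reduces the lower
          -- truncation to an additive `c`.
          refine (ENNReal.lintegral_Lp_add_le (f := fun x => ENNReal.ofReal (u x))
            (g := fun _ => ENNReal.ofReal c) mu.aemeasurable aemeasurable_const
            (by linarith)).trans (add_le_add le_rfl ?_)
          rw [lintegral_const, measure_univ, mul_one, ← ENNReal.rpow_mul,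
            mul_one_div_cancel hp1.ne', ENNReal.rpow_one]
  have step2 : ∀ c : ℝ, 0 < c →
      ∫⁻ x, ENNReal.ofReal (u x) ^ p ∂ν ≤ (A + ENNReal.ofReal c) ^ p + K := by
    intro c hc
    -- The upper levels start at `c`, so that each is an admissible truncation level.
    have e : ∀ x, ENNReal.ofReal (u x) ^ p =
        ⨆ n : ℕ, ENNReal.ofReal (min (u x) (c + n)) ^ p := by
      intro x
      refine le_antisymm ?_ (iSup_le fun n => ENNReal.rpow_le_rpow
        (ENNReal.ofReal_le_ofReal (min_le_left _ _)) hp0.le)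
      obtain ⟨n, hn⟩ := exists_nat_ge (u x)
      refine le_iSup_of_le n ?_
      rw [min_eq_left (by linarith)]
    rw [lintegral_congr e, lintegral_iSup (fun n => by fun_prop)]
    · exact iSup_le fun n => step1 c _ hc (by simp)
    · intro i j hij x
      refine ENNReal.rpow_le_rpow (ENNReal.ofReal_le_ofReal (min_le_min le_rfl ?_)) hp0.le
      have : (i : ℝ) ≤ j := by exact_mod_cast hij
      linarith
  have lim : Filter.Tendsto (fun c : ℝ => (A + ENNReal.ofReal c) ^ p + K)
      (nhdsWithin 0 (Set.Ioi 0)) (nhds (A ^ p + K)) := by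
    have hcont : Continuous fun c : ℝ => (A + ENNReal.ofReal c) ^ p + K :=
      (ENNReal.continuous_rpow_const.comp
        (continuous_const.add ENNReal.continuous_ofReal)).add continuous_const
    have := (hcont.tendsto 0).mono_left (nhdsWithin_le_nhds (s := Set.Ioi 0))
    simpa using this
  exact ge_of_tendsto lim (eventually_nhdsWithin_of_forall fun c hc => step2 c hc)

/-- Hölder's inequality with exponents `p / 2` and `p / (p - 2)`. For `p = 2` the second exponent
degenerates, but the weight is then identically `1`. -/
lemma lintegral_rpow_mul_le {E : Type*} [MeasurableSpace E] {ν : Measure E}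
    [IsProbabilityMeasure ν] {a v : E → ℝ≥0∞} (ha : AEMeasurable a ν) (hv : AEMeasurable v ν)
    {p : ℝ} (hp : 2 ≤ p) :
    ∫⁻ x, a x ^ (p - 2) * v x ∂ν ≤
      (∫⁻ x, v x ^ (p / 2) ∂ν) ^ (1 / (p / 2)) * ((∫⁻ x, a x ^ p ∂ν) ^ (1 / p)) ^ (p - 2) := by
  rcases hp.eq_or_lt with rfl | hp
  · simp
  have h2 : 0 < p - 2 := by linarith
  have hq : (p / 2).HolderConjugate (p / (p - 2)) := by
    rw [Real.holderConjugate_iff]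
    refine ⟨by linarith, ?_⟩
    field_simp
    ring
  have h := ENNReal.lintegral_mul_le_Lp_mul_Lq ν hq hv (ha.pow_const (p - 2))
  refine le_trans (le_of_eq (lintegral_congr fun x => ?_)) (h.trans (le_of_eq ?_))
  · simp [mul_comm]
  · congr 1
    rw [← ENNReal.rpow_mul]
    congr 1
    · refine lintegral_congr fun x => ?_
      rw [← ENNReal.rpow_mul, mul_div_cancel₀ _ h2.ne']
    · field_simp

end VPlus

theorem proposition3p1 {X Ω : Type*} [MeasurableSpace X] [MeasurableSpace Ω]
    (P : Measure Ω) [IsProbabilityMeasure P] (μ : Measure X) [SigmaFinite μ]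
    (η : Ω → CountingMeasure X) (hη : IsPoissonProcess P μ η)
    (F : Ω → ℝ) (f : CountingMeasure X → ℝ) (hf : IsRepresentative P η F f)
    (hF : Integrable F P) (p : ℝ) (hp : 2 ≤ p) :
    pNorm P p (fun ω => max 0 (F ω - ∫ ω', F ω' ∂P)) ^ p ≤
      pNorm P (p - 1) (fun ω => max 0 (F ω - ∫ ω', F ω' ∂P)) ^ p +
        ENNReal.ofReal (p - 1) * pNorm P (p / 2) (fun ω => vPlus μ f (η ω)) *
          pNorm P p (fun ω => max 0 (F ω - ∫ ω', F ω' ∂P)) ^ (p - 2) := by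
  have hη' := hη.measurable
  have hprob : IsProbabilityMeasure (P.map η) :=
    Measure.isProbabilityMeasure_map hη'.aemeasurable
  have hQ := hη.map_id
  have hfm := hf.measurable
  -- The argument works with any real centring constant.
  generalize (∫ ω', F ω' ∂P) = m
  have mu : Measurable fun ξ => max 0 (f ξ - m) := by fun_prop
  have norm_eq : ∀ q : ℝ, ∫⁻ ω, ‖max 0 (F ω - m)‖ₑ ^ q ∂P =
      ∫⁻ ξ, ENNReal.ofReal (max 0 (f ξ - m)) ^ q ∂(P.map η) := by
    intro q
    rw [lintegral_map (by fun_prop) hη']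
    refine lintegral_congr_ae ?_
    filter_upwards [hf.ae_eq] with ω hω
    rw [hω, Real.enorm_eq_ofReal (le_max_left _ _)]
  -- The weight `1` is a dummy: only the almost everywhere measurability of `V⁺` is taken from here.
  have hV := (hQ.lintegral_mul_vPlus hfm (measurable_const (a := (1 : ℝ≥0∞)))).1
  have norm_V : ∫⁻ ω, ‖vPlus μ f (η ω)‖ₑ ^ (p / 2) ∂P =
      ∫⁻ ξ, vPlus μ f ξ ^ (p / 2) ∂(P.map η) := by
    rw [lintegral_map' (hV.pow_const _) hη'.aemeasurable]
    rfl
  simp only [pNorm, norm_eq, norm_V]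
  rw [← ENNReal.rpow_mul, one_div_mul_cancel (by linarith), ENNReal.rpow_one]
  refine (lintegral_rpow_le_of_clamp mu (fun ξ => le_max_left _ _) hp fun c n hc hcn =>
    hQ.lintegral_clamp_rpow_le hfm m hp hc hcn).trans (add_le_add le_rfl ?_)
  rw [mul_assoc]
  gcongr
  exact lintegral_rpow_mul_le mu.ennreal_ofReal.aemeasurable hV hp
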